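/- For integers $m\ge 1$, $b$ with $(b,m)=1$ and $Q\ge 1$ let $$\mathfrak F_Q^{(m,b)}=\Big\{\tfrac aq : 0<a\le q\le Q,\ (a,q)=1,\ q\equiv b \!\!\pmod m\Big\},$$ and put $$C_m=\frac{\varphi(m)}{\zeta(2)m}\prod_{p\mid m}\Big(1-\frac1{p^2}\Big)^{-1},\qquad g_{(m)}(\lambda)=\frac{\varphi(m)}{m}\cdot\frac{C_m}{\lambda^2}\sum_{1\le\Delta\le 2\lambda/C_m}\varphi(\Delta)\,\frac{(\Delta,m)}{\varphi((\Delta,m))}\,\log\frac{2\lambda}{C_m\Delta}\quad(\lambda>0).$$ For a finite set $F\subset\mathbb R$ with $N$ elements and an interval $I\subseteq\mathbb R$ let $$\mathcal G_F(I)=\frac1N\#\Big\{(x,y)\in F^2: y\ne x,\ y-x\in\tfrac1N I+\mathbb Z\Big\}.$$ The pair correlation measure of a sequence $(F_n)$ of finite sets is the measure $\mathcal G$ on $\mathbb R$ with $\mathcal G(I)=\lim_n\mathcal G_{F_n}(I)\in[0,\infty]$ for every interval $I$, if it exists; a function $g$ is the pair correlation function of $(F_n)$ if moreover $\mathcal G([0,\lambda])=\int_0^\lambda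 g(x)\,dx<\infty$ for all $\lambda\ge 0$. **Theorem.** Let $m\ge1$. For every integer $b$ with $(b,m)=1$ the pair correlation function of $(\mathfrak F_Q^{(m,b)})_{Q\ge1}$ exists; it does not depend on $b$ and is given by $$\widetilde g_{(m)}(\lambda)=g_{(m)}(\varphi(m)\lambda).$$ Moreover, for all $\delta>0$ and $K>0$, $$\frac1N\#\Big\{(\gamma,\gamma')\in F^2: 0<\gamma'-\gamma\le\frac{\lambda}{N}\Big\}=\int_0^\lambda\widetilde g_{(m)}(x)\,dx+O_{\delta,m,K}\big(Q^{-1/2+\delta}\big),\qquad F=\mathfrak F_Q^{(m,b)},\ N=\#F,$$ uniformly in $0\le\lambda\le K$, in $Q\ge1$ and in $b$ with $(b,m)=1$ (for the finitely many $Q$ with $F=\emptyset$ the left side is read as $0$), and the same holds with $\mathcal G_F([0,\lambda])$ on the left side. -/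

import Mathlib

open MeasureTheory Filter Topology

noncomputable section

namespace FareyPair

/-- `𝒢_F(I) = (1/N) #{(x,y) ∈ F² : y ≠ x, y - x ∈ (1/N) I + ℤ}`, where `N = #F`. -/
def pairCorr (F : Finset ℝ) (I : Set ℝ) : ℝ :=
  (1 / (F.card : ℝ)) *
    (Set.ncard {p : ℝ × ℝ | p.1 ∈ F ∧ p.2 ∈ F ∧ p.2 ≠ p.1 ∧
      ∃ t ∈ I, ∃ k : ℤ, p.2 - p.1 = t / (F.card : ℝ) + (k : ℝ)} : ℝ)

/-- `𝒢` is the pair correlation measure of the sequence `F`: `𝒢(I) = lim 𝒢_{F n}(I)` for every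
interval `I` of the real line, bounded or not (the limit is taken in `[0, ∞]`). -/
def IsPairCorrMeasure (F : ℕ → Finset ℝ) (𝒢 : Measure ℝ) : Prop :=
  ∀ I : Set ℝ, I.OrdConnected →
    Tendsto (fun n => ENNReal.ofReal (pairCorr (F n) I)) atTop (𝓝 (𝒢 I))

/-- The pair correlation measure of `F` exists and `g` is the pair correlation function of `F`:
`𝒢([0, L]) = ∫_0^L g` for all `L ≥ 0`, both sides being finite. -/
def HasPairCorrFunction (F : ℕ → Finset ℝ) (g : ℝ → ℝ) : Prop :=
  ∃ 𝒢 : Measure ℝ, IsPairCorrMeasure F 𝒢 ∧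
    ∀ L : ℝ, 0 ≤ L → 𝒢 (Set.Icc 0 L) < ⊤ ∧ IntervalIntegrable g volume 0 L ∧
      (𝒢 (Set.Icc 0 L)).toReal = ∫ x in (0 : ℝ)..L, g x

/-- `(1/N) #{(x,y) ∈ F² : 0 < y - x ≤ L/N}`, where `N = #F`. -/
def cumulCorr (F : Finset ℝ) (L : ℝ) : ℝ :=
  (1 / (F.card : ℝ)) *
    (Set.ncard {p : ℝ × ℝ | p.1 ∈ F ∧ p.2 ∈ F ∧
      0 < p.2 - p.1 ∧ p.2 - p.1 ≤ L / (F.card : ℝ)} : ℝ)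

/-- The Farey fractions `a/q` with `0 < a ≤ q ≤ Q`, `(a,q) = 1` and `q ≡ b (mod m)`. -/
def fareyMod (m : ℕ) (b : ℤ) (Q : ℕ) : Finset ℝ :=
  ((Finset.Icc 1 Q ×ˢ Finset.Icc 1 Q).filter (fun p : ℕ × ℕ =>
    p.1 ≤ p.2 ∧ Nat.Coprime p.1 p.2 ∧ (p.2 : ℤ) ≡ b [ZMOD (m : ℤ)])).image
      (fun p : ℕ × ℕ => (p.1 : ℝ) / (p.2 : ℝ))

/-- `C_m = φ(m) / (ζ(2) m) ∏_{p ∣ m} (1 - 1/p²)⁻¹`. -/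
def constC (m : ℕ) : ℝ :=
  (Nat.totient m : ℝ) / ((riemannZeta 2).re * (m : ℝ)) *
    ∏ p ∈ m.primeFactors, (1 - 1 / (p : ℝ) ^ 2)⁻¹

/-- `g_(m)(x) = (φ(m)/m) (C_m/x²) ∑_{1 ≤ Δ ≤ 2x/C_m} φ(Δ) ((Δ,m)/φ((Δ,m))) log(2x/(C_m Δ))`. -/
def gCoprime (m : ℕ) (x : ℝ) : ℝ :=
  (Nat.totient m : ℝ) / (m : ℝ) * (constC m / x ^ 2) *
    ∑ Δ ∈ Finset.Icc 1 ⌊2 * x / constC m⌋₊,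
      (Nat.totient Δ : ℝ) * ((Nat.gcd Δ m : ℝ) / (Nat.totient (Nat.gcd Δ m) : ℝ)) *
        Real.log (2 * x / (constC m * (Δ : ℝ)))

end FareyPair

end

/-!
The elements of `F = fareyMod m b Q` are determined by the pairs of coprime integers `(a, q)`, and
`a' / q' - a / q = Δ / (q q')` with `Δ = a' q - a q'`. As `N = #F` is of order `Q ^ 2`, pairs at
distance at most `L / N` have `Δ` bounded. For fixed `q` and `Δ`, detecting `(a', q') = 1` by
Möbius inversion over the divisors of `Δ` leaves a congruence `a r ≡ -D (mod q)` in the reduced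
residue `a`. Its number of solutions depends on `r` only through `(r, q)`, so a second Möbius
inversion shows that its sum over the `r` in an interval and a progression modulo `m` is, up to
`O(d(q)) = O(√q)`, proportional to `φ(q) / q` and to the length of the interval. The sum over `q`
follows by partial summation from the mean value `C_m / φ(m)` of `φ(q) / q` on the progression, and
its dependence on `L` is, up to scaling, a primitive of `log y / y ^ 2`. The limit measure has
density `g (|x|)`; bounded intervals are reduced to `[0, L]` by evenness and additivity, and on
unbounded ones both sides tend to infinity.
-/

namespace FareyPair

open scoped Finset Nat ArithmeticFunction.Moebius

/-! ### Möbius inversion in arithmetic progressions -/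

lemma exists_forall_mul_modEq_iff {m k : ℕ} (hm : 0 < m) (hk : k.Coprime m) (b : ℤ) :
    ∃ v : ℕ, ∀ s : ℕ, (k : ℤ) * s ≡ b [ZMOD m] ↔ s ≡ v [MOD m] := by
  have : NeZero m := ⟨hm.ne'⟩
  refine ⟨(((ZMod.unitOfCoprime k hk)⁻¹ : (ZMod m)ˣ) * (b : ZMod m)).val, fun s => ?_⟩
  rw [← ZMod.intCast_eq_intCast_iff, ← ZMod.natCast_eq_natCast_iff, ZMod.natCast_zmod_val,
    Units.eq_inv_mul_iff_mul_eq, ZMod.coe_unitOfCoprime, Int.cast_mul, Int.cast_natCast,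
    Int.cast_natCast]

lemma abs_card_Ico_filter_modEq_sub_le {m : ℕ} (hm : 0 < m) (v : ℕ) {s t : ℕ} (hst : s ≤ t) :
    |(#{x ∈ Finset.Ico s t | x ≡ v [MOD m]} : ℝ) - ((t : ℝ) - s) / m| ≤ 1 := by
  have hcard := Nat.Ico_filter_modEq_card s t hm v
  set x : ℚ := ((s : ℚ) - v) / m with hx
  set y : ℚ := ((t : ℚ) - v) / m with hy
  have hcard : (#{x ∈ Finset.Ico s t | x ≡ v [MOD m]} : ℝ) = max ((⌈y⌉ : ℝ) - ⌈x⌉) 0 := by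
    exact_mod_cast hcard
  have hxy : ((t : ℝ) - s) / m = (y : ℝ) - x := by
    rw [hx, hy]
    push_cast
    ring
  have hxy0 : 0 ≤ (y : ℝ) - x := by
    rw [← hxy]
    exact div_nonneg (sub_nonneg.2 (by exact_mod_cast hst)) (Nat.cast_nonneg m)
  have hx_le : (x : ℝ) ≤ ⌈x⌉ := by exact_mod_cast Int.le_ceil x
  have hx_lt : (⌈x⌉ : ℝ) < x + 1 := by exact_mod_cast Int.ceil_lt_add_one x
  have hy_le : (y : ℝ) ≤ ⌈y⌉ := by exact_mod_cast Int.le_ceil y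
  have hy_lt : (⌈y⌉ : ℝ) < y + 1 := by exact_mod_cast Int.ceil_lt_add_one y
  rw [hcard, hxy, abs_le]
  constructor
  · linarith [le_max_left ((⌈y⌉ : ℝ) - ⌈x⌉) 0]
  · have : max ((⌈y⌉ : ℝ) - ⌈x⌉) 0 ≤ (y : ℝ) - x + 1 := max_le (by linarith) (by linarith)
    linarith

lemma abs_card_filter_mul_modEq_sub_le {m : ℕ} (hm : 0 < m) (b : ℤ) {k : ℕ} (hk : k.Coprime m)
    {α β : ℝ} (h0 : 0 ≤ α) (h : α ≤ β) :
    |(#{s ∈ Finset.Icc ⌈α⌉₊ ⌊β⌋₊ | (k : ℤ) * (s : ℕ) ≡ b [ZMOD m]} : ℝ) -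
      (β - α) / m| ≤ 2 := by
  obtain ⟨v, hv⟩ := exists_forall_mul_modEq_iff hm hk b
  have hα := Nat.ceil_lt_add_one h0
  have hβ := Nat.lt_floor_add_one β
  have hle : ⌈α⌉₊ ≤ ⌊β⌋₊ + 1 := Nat.ceil_le.2 (by push_cast; linarith)
  have hcount := abs_card_Ico_filter_modEq_sub_le hm v hle
  have hset : {s ∈ Finset.Icc ⌈α⌉₊ ⌊β⌋₊ | (k : ℤ) * (s : ℕ) ≡ b [ZMOD m]} =
      {x ∈ Finset.Ico ⌈α⌉₊ (⌊β⌋₊ + 1) | x ≡ v [MOD m]} := by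
    ext s
    simp only [Finset.mem_filter, Finset.mem_Icc, Finset.mem_Ico, hv, Nat.lt_succ_iff]
  have hends : |(((⌊β⌋₊ + 1 : ℕ) : ℝ) - (⌈α⌉₊ : ℕ)) / m - (β - α) / m| ≤ 1 := by
    rw [← sub_div, abs_div, Nat.abs_cast, div_le_one (by exact_mod_cast hm)]
    refine le_trans ?_ (by exact_mod_cast hm : (1 : ℝ) ≤ m)
    push_cast
    rw [abs_le]
    constructor <;> linarith [Nat.le_ceil α, Nat.floor_le (h0.trans h)]
  rw [hset]
  linarith [abs_sub_le (#{x ∈ Finset.Ico ⌈α⌉₊ (⌊β⌋₊ + 1) | x ≡ v [MOD m]} : ℝ)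
    ((((⌊β⌋₊ + 1 : ℕ) : ℝ) - (⌈α⌉₊ : ℕ)) / m) ((β - α) / m)]

lemma abs_card_filter_dvd_mul_modEq_sub_le {m : ℕ} (hm : 0 < m) (b : ℤ) {e t : ℕ} (ht : 0 < t)
    (h : (e * t).Coprime m) {α β : ℝ} (h0 : 0 ≤ α) (hαβ : α ≤ β) :
    |(#{r ∈ Finset.Icc ⌈α⌉₊ ⌊β⌋₊ | t ∣ r ∧ (e : ℤ) * (r : ℕ) ≡ b [ZMOD m]} : ℝ) -
      (β - α) / (t * m)| ≤ 2 := by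
  have ht' : (0 : ℝ) < t := by exact_mod_cast ht
  have key := abs_card_filter_mul_modEq_sub_le hm b h (α := α / t) (β := β / t) (by positivity)
    (by gcongr)
  have hmem : ∀ s : ℕ, t * s ∈ Finset.Icc ⌈α⌉₊ ⌊β⌋₊ ↔ s ∈ Finset.Icc ⌈α / t⌉₊ ⌊β / t⌋₊ := by
    intro s
    simp only [Finset.mem_Icc, Nat.ceil_le, Nat.le_floor_iff (h0.trans hαβ),
      Nat.le_floor_iff (div_nonneg (h0.trans hαβ) ht'.le), div_le_iff₀' ht', le_div_iff₀' ht',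
      Nat.cast_mul]
  have himage : {r ∈ Finset.Icc ⌈α⌉₊ ⌊β⌋₊ | t ∣ r ∧ (e : ℤ) * (r : ℕ) ≡ b [ZMOD m]} =
      {s ∈ Finset.Icc ⌈α / t⌉₊ ⌊β / t⌋₊ | ((e * t : ℕ) : ℤ) * (s : ℕ) ≡ b [ZMOD m]}.image
        (t * ·) := by
    ext r
    simp only [Finset.mem_filter, Finset.mem_image]
    constructor
    · rintro ⟨hr, ⟨s, rfl⟩, hs⟩
      exact ⟨s, ⟨(hmem s).1 hr, by push_cast at hs ⊢; rwa [mul_assoc]⟩, rfl⟩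
    · rintro ⟨s, ⟨hs, hsb⟩, rfl⟩
      exact ⟨(hmem s).2 hs, dvd_mul_right t s, by push_cast at hsb ⊢; rwa [← mul_assoc]⟩
  rw [himage, Finset.card_image_of_injective _ fun _ _ => Nat.eq_of_mul_eq_mul_left ht]
  convert key using 3
  field_simp

lemma coprime_of_mul_modEq {m k l : ℕ} {b : ℤ} (hb : IsCoprime b (m : ℤ))
    (h : (k : ℤ) * l ≡ b [ZMOD m]) : k.Coprime m := by
  obtain ⟨c, hc⟩ := Int.modEq_iff_dvd.1 h.symm
  have hkl : IsCoprime ((k : ℤ) * l) m := by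
    rw [show (k : ℤ) * l = b + m * c by linarith]
    exact hb.add_mul_left_left c
  exact Nat.isCoprime_iff_coprime.1 hkl.of_mul_left_left

lemma sum_divisors_moebius_mul {R : Type*} [CommRing R] {f : ArithmeticFunction R}
    (hf : f.IsMultiplicative) {n : ℕ} (hn : n ≠ 0) :
    ∑ d ∈ n.divisors, (μ d : R) * f d = ∏ p ∈ n.primeFactors, (1 - f p) := by
  set r := ∏ p ∈ n.primeFactors, p with hr
  have hprime : ∀ p ∈ n.primeFactors, p.Prime := fun _ => Nat.prime_of_mem_primeFactors
  have hrn : r ∣ n := Nat.prod_primeFactors_dvd n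
  have hr0 : r ≠ 0 := ne_zero_of_dvd_ne_zero hn hrn
  have hsq : Squarefree r := Finset.squarefree_prod_of_pairwise_isCoprime
    (fun p hp q hq hpq => Nat.coprime_iff_isRelPrime.1
      ((Nat.coprime_primes (hprime p hp) (hprime q hq)).2 hpq))
    fun p hp => (hprime p hp).squarefree
  rw [← Nat.primeFactors_prod hprime, ← hr,
    ArithmeticFunction.IsMultiplicative.prodPrimeFactors_one_sub_of_squarefree f hf hsq]
  refine (Finset.sum_subset (Nat.divisors_subset_of_dvd hn hrn) fun d hd hdr => ?_).symm
  have hd_sq : ¬ Squarefree d := fun hd_sq => hdr <| Nat.mem_divisors.2 ⟨by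
    rw [← Nat.prod_primeFactors_of_squarefree hd_sq, hr]
    exact Finset.prod_dvd_prod_of_subset _ _ _
      (Nat.primeFactors_mono (Nat.dvd_of_mem_divisors hd) hn), hr0⟩
  rw [ArithmeticFunction.moebius_eq_zero_of_not_squarefree hd_sq, Int.cast_zero, zero_mul]

lemma sum_divisors_moebius (n : ℕ) : ∑ d ∈ n.divisors, (μ d : ℝ) = if n = 1 then 1 else 0 := by
  have h := congrArg (fun F : ArithmeticFunction ℤ => F n) ArithmeticFunction.moebius_mul_coe_zeta
  simp only [ArithmeticFunction.coe_mul_zeta_apply, ArithmeticFunction.one_apply] at h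
  exact_mod_cast h

lemma abs_moebius_cast_le_one (k : ℕ) : |(μ k : ℝ)| ≤ 1 := by
  exact_mod_cast ArithmeticFunction.abs_moebius_le_one

/-- The arithmetic function equal to `1 / n` at the `n` prime to `m` and to `0` elsewhere; twisted
by `μ` it produces the densities of all the sieves below. -/
noncomputable def invCoprime (m : ℕ) : ArithmeticFunction ℝ :=
  ⟨fun n => if n.Coprime m then (n : ℝ)⁻¹ else 0, by simp⟩

lemma invCoprime_apply (m n : ℕ) :
    invCoprime m n = if n.Coprime m then (n : ℝ)⁻¹ else 0 := rfl

lemma abs_invCoprime_le (m k : ℕ) : |invCoprime m k| ≤ (k : ℝ)⁻¹ := by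
  rw [invCoprime_apply]
  split_ifs
  · rw [abs_of_nonneg (by positivity)]
  · simp

lemma isMultiplicative_invCoprime (m : ℕ) : (invCoprime m).IsMultiplicative := by
  refine ⟨by simp [invCoprime_apply], fun {a c} _ => ?_⟩
  simp only [invCoprime_apply, Nat.coprime_mul_iff_left, Nat.cast_mul, mul_inv]
  split_ifs <;> simp_all

lemma totient_div_self_eq_prod {n : ℕ} (hn : n ≠ 0) :
    (φ n : ℝ) / n = ∏ p ∈ n.primeFactors, (1 - (p : ℝ)⁻¹) := by
  have h := congrArg (fun x : ℚ => (x : ℝ)) (Nat.totient_eq_mul_prod_factors n)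
  push_cast at h
  rw [h, mul_div_cancel_left₀ _ (by exact_mod_cast hn)]

lemma totient_div_self_eq_sum {n : ℕ} (hn : n ≠ 0) :
    (φ n : ℝ) / n = ∑ d ∈ n.divisors, (μ d : ℝ) / d := by
  have h := sum_divisors_moebius_mul (isMultiplicative_invCoprime 1) hn
  simp only [invCoprime_apply, Nat.coprime_one_right_eq_true, if_true] at h
  rw [totient_div_self_eq_prod hn, ← h]
  simp only [div_eq_mul_inv]

lemma sum_divisors_moebius_invCoprime {m n : ℕ} (hm : m ≠ 0) (hn : n ≠ 0) :
    ∑ d ∈ n.divisors, (μ d : ℝ) * invCoprime m d =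
      (φ n : ℝ) / n * ((Nat.gcd n m : ℝ) / φ (Nat.gcd n m)) := by
  have hg : Nat.gcd n m ≠ 0 := Nat.gcd_ne_zero_left hn
  have hg' : (0 : ℝ) < Nat.gcd n m := by exact_mod_cast Nat.pos_of_ne_zero hg
  have hφ : (0 : ℝ) < φ (Nat.gcd n m) := by
    exact_mod_cast Nat.totient_pos.2 (Nat.pos_of_ne_zero hg)
  rw [sum_divisors_moebius_mul (isMultiplicative_invCoprime m) hn,
    ← inv_div (φ (Nat.gcd n m) : ℝ), ← div_eq_mul_inv, eq_div_iff (div_pos hφ hg').ne',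
    totient_div_self_eq_prod hg, totient_div_self_eq_prod hn, Nat.primeFactors_gcd hn hm,
    ← Finset.filter_mem_eq_inter, Finset.prod_filter, ← Finset.prod_mul_distrib]
  refine Finset.prod_congr rfl fun p hp => ?_
  have hpp := Nat.prime_of_mem_primeFactors hp
  by_cases h : p ∣ m
  · simp [invCoprime_apply, hpp, h, hm, hpp.coprime_iff_not_dvd]
  · simp [invCoprime_apply, h, hpp.coprime_iff_not_dvd]

lemma sum_totient_div_eq_sum_moebius_mul_card {S : Finset ℕ} {n : ℕ} (hS : S ⊆ Finset.Icc 1 n) :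
    ∑ q ∈ S, (φ q : ℝ) / q = ∑ k ∈ Finset.Icc 1 n, (μ k : ℝ) / k * #{q ∈ S | k ∣ q} := by
  have hdiv : ∀ q ∈ S, (φ q : ℝ) / q = ∑ k ∈ Finset.Icc 1 n with k ∣ q, (μ k : ℝ) / k := by
    intro q hq
    obtain ⟨hq1, hqn⟩ := Finset.mem_Icc.1 (hS hq)
    rw [totient_div_self_eq_sum (by omega)]
    refine Finset.sum_congr (Finset.ext fun k => ?_) fun _ _ => rfl
    simp only [Nat.mem_divisors, Finset.mem_filter, Finset.mem_Icc]
    exact ⟨fun h => ⟨⟨Nat.pos_of_dvd_of_pos h.1 hq1, (Nat.le_of_dvd hq1 h.1).trans hqn⟩, h.1⟩,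
      fun h => ⟨h.2, by omega⟩⟩
  simp_rw [Finset.sum_congr rfl hdiv, Finset.sum_filter]
  rw [Finset.sum_comm]
  refine Finset.sum_congr rfl fun k _ => ?_
  rw [← Finset.sum_filter, Finset.sum_const, nsmul_eq_mul, mul_comm]

lemma sum_Icc_inv_le_two_sqrt_sub_one {n : ℕ} (hn : 1 ≤ n) :
    ∑ k ∈ Finset.Icc 1 n, (k : ℝ)⁻¹ ≤ 2 * √n - 1 := by
  have hharm := harmonic_le_one_add_log n
  rw [harmonic_eq_sum_Icc] at hharm
  push_cast at hharm
  have hn' : (0 : ℝ) < n := by exact_mod_cast hn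
  have hlog := Real.log_le_sub_one_of_pos (Real.sqrt_pos.2 hn')
  rw [Real.log_sqrt hn'.le] at hlog
  linarith

lemma card_divisors_le_two_sqrt (n : ℕ) : (#n.divisors : ℝ) ≤ 2 * √n := by
  have hsub : n.divisors ⊆ Finset.Icc 1 n.sqrt ∪ (Finset.Icc 1 n.sqrt).image (n / ·) := by
    intro d hd
    obtain ⟨⟨c, rfl⟩, h0⟩ := Nat.mem_divisors.1 hd
    obtain ⟨hd0, hc0⟩ := Nat.mul_ne_zero_iff.1 h0
    simp only [Finset.mem_union, Finset.mem_image, Finset.mem_Icc, Nat.le_sqrt]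
    rcases le_total d c with h | h
    · exact Or.inl ⟨Nat.pos_of_ne_zero hd0, Nat.mul_le_mul_left _ h⟩
    · exact Or.inr ⟨c, ⟨Nat.pos_of_ne_zero hc0, Nat.mul_le_mul_right _ h⟩,
        Nat.mul_div_cancel _ (Nat.pos_of_ne_zero hc0)⟩
  have hcard : #n.divisors ≤ 2 * n.sqrt := by
    refine (Finset.card_le_card hsub).trans ((Finset.card_union_le _ _).trans ?_)
    have := Finset.card_image_le (s := Finset.Icc 1 n.sqrt) (f := (n / ·))
    simp only [Nat.card_Icc, add_tsub_cancel_right] at this ⊢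
    omega
  calc (#n.divisors : ℝ) ≤ 2 * (n.sqrt : ℝ) := by exact_mod_cast hcard
    _ ≤ 2 * √n := by gcongr; exact Real.nat_sqrt_le_real_sqrt

lemma re_riemannZeta_two_pos : 0 < (riemannZeta 2).re := by
  simpa using riemannZeta_re_pos_of_one_lt (x := 2) (by norm_num)

lemma constC_pos {m : ℕ} (hm : 0 < m) : 0 < constC m := by
  have hφ : (0 : ℝ) < φ m := by exact_mod_cast Nat.totient_pos.2 hm
  have hm0 : (0 : ℝ) < m := by exact_mod_cast hm
  refine mul_pos (div_pos hφ (mul_pos re_riemannZeta_two_pos hm0)) (Finset.prod_pos fun p hp => ?_)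
  have hp : (1 : ℝ) < p := by exact_mod_cast (Nat.prime_of_mem_primeFactors hp).one_lt
  exact inv_pos.2 (sub_pos.2 ((div_lt_one (by positivity)).2 (one_lt_pow₀ hp two_ne_zero)))

/-- The density `C_m / φ(m)` of the weights `φ(q) / q` carried by a progression `q ≡ b (mod m)`
with `b` prime to `m`: they add up to about `totientDensity m * n` over `q ≤ n`, so that
`𝔉_Q^{(m,b)}` has about `totientDensity m * Q ^ 2 / 2` elements. -/
noncomputable def totientDensity (m : ℕ) : ℝ := constC m / φ m

lemma totientDensity_pos {m : ℕ} (hm : 0 < m) : 0 < totientDensity m :=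
  div_pos (constC_pos hm) (by exact_mod_cast Nat.totient_pos.2 hm)

lemma constC_eq_totient_mul {m : ℕ} (hm : 0 < m) : constC m = φ m * totientDensity m :=
  (mul_div_cancel₀ _ (by exact_mod_cast (Nat.totient_pos.2 hm).ne')).symm

lemma mul_totientDensity {m : ℕ} (hm : 0 < m) :
    m * totientDensity m =
      ((∏ p ∈ m.primeFactors, (1 - 1 / (p : ℝ) ^ 2)) * (riemannZeta 2).re)⁻¹ := by
  have hφ : (φ m : ℝ) ≠ 0 := by exact_mod_cast (Nat.totient_pos.2 hm).ne'
  have hm0 : (m : ℝ) ≠ 0 := by exact_mod_cast hm.ne'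
  rw [totientDensity, constC, Finset.prod_inv_distrib, mul_inv]
  field_simp

lemma LSeries_trivChar_mul_moebius {m : ℕ} [NeZero m] {s : ℂ} (hs : 1 < s.re) :
    LSeries ((fun n : ℕ => (1 : DirichletCharacter ℂ m) n) * fun n : ℕ => (μ n : ℂ)) s =
      ((∏ p ∈ m.primeFactors, (1 - (p : ℂ) ^ (-s))) * riemannZeta s)⁻¹ := by
  have hmul := DirichletCharacter.LSeries.mul_mu_eq_one (1 : DirichletCharacter ℂ m) hs
  have hs1 : s ≠ 1 := fun h => by simp [h] at hs
  have htriv := DirichletCharacter.LFunctionTrivChar_eq_mul_riemannZeta (N := m) hs1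
  rw [DirichletCharacter.LFunctionTrivChar] at htriv
  rw [← DirichletCharacter.LFunction_eq_LSeries _ hs, htriv] at hmul
  exact eq_inv_of_mul_eq_one_right hmul

lemma term_trivChar_mul_moebius_two {m : ℕ} (k : ℕ) :
    LSeries.term ((fun n : ℕ => (1 : DirichletCharacter ℂ m) n) * fun n : ℕ => (μ n : ℂ)) 2 k =
      ((μ k * invCoprime m k / k : ℝ) : ℂ) := by
  rcases eq_or_ne k 0 with rfl | hk
  · simp
  have hk' : (k : ℂ) ≠ 0 := by exact_mod_cast hk
  rw [LSeries.term_of_ne_zero hk, Pi.mul_apply, invCoprime_apply, Complex.cpow_ofNat]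
  split_ifs with hkm
  · rw [MulChar.one_apply ((ZMod.isUnit_iff_coprime k m).2 hkm)]
    push_cast
    field_simp
  · rw [MulChar.map_nonunit _ fun h => hkm ((ZMod.isUnit_iff_coprime k m).1 h)]
    simp

lemma hasSum_moebius_invCoprime_div {m : ℕ} (hm : 0 < m) :
    HasSum (fun k : ℕ => (μ k : ℝ) * invCoprime m k / k) (m * totientDensity m) := by
  have : NeZero m := ⟨hm.ne'⟩
  have hs : (1 : ℝ) < (2 : ℂ).re := by norm_num
  have hzeta : riemannZeta 2 = ((riemannZeta 2).re : ℂ) := by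
    rw [riemannZeta_two]
    norm_cast
  have hsum := (DirichletCharacter.LSeriesSummable_mul (1 : DirichletCharacter ℂ m)
    (ArithmeticFunction.LSeriesSummable_moebius_iff.2 hs)).hasSum
  rw [← LSeries, LSeries_trivChar_mul_moebius hs, hzeta] at hsum
  rw [mul_totientDensity hm, ← Complex.hasSum_ofReal]
  convert hsum using 1
  · exact funext fun k => (term_trivChar_mul_moebius_two k).symm
  · push_cast
    simp only [one_div, Complex.cpow_neg, Complex.cpow_ofNat]

lemma abs_sum_moebius_invCoprime_sub_le {m : ℕ} (hm : 0 < m) (n : ℕ) :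
    |∑ k ∈ Finset.Icc 1 n, (μ k : ℝ) * invCoprime m k / k - m * totientDensity m| ≤
      2 / (n + 1) := by
  have hlim : Tendsto (fun M : ℕ => |∑ k ∈ Finset.Icc 1 n, (μ k : ℝ) * invCoprime m k / k -
      ∑ k ∈ Finset.range M, (μ k : ℝ) * invCoprime m k / k|) atTop
      (𝓝 |∑ k ∈ Finset.Icc 1 n, (μ k : ℝ) * invCoprime m k / k - m * totientDensity m|) :=
    (tendsto_const_nhds.sub (hasSum_moebius_invCoprime_div hm).tendsto_sum_nat).abs
  refine le_of_tendsto hlim ?_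
  filter_upwards [eventually_gt_atTop n] with M hM
  have hrange : Finset.range M = insert 0 (Finset.Icc 1 n ∪ Finset.Ioo n M) := by
    ext k
    simp only [Finset.mem_range, Finset.mem_insert, Finset.mem_union, Finset.mem_Icc,
      Finset.mem_Ioo]
    omega
  have hdisj : Disjoint (Finset.Icc 1 n) (Finset.Ioo n M) :=
    Finset.disjoint_left.2 fun k hk hk' => by
      rw [Finset.mem_Icc] at hk
      rw [Finset.mem_Ioo] at hk'
      omega
  rw [hrange, Finset.sum_insert (by simp), Finset.sum_union hdisj, Nat.cast_zero, div_zero,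
    zero_add, sub_add_cancel_left, abs_neg]
  refine (Finset.abs_sum_le_sum_abs _ _).trans
    ((Finset.sum_le_sum fun k _ => ?_).trans (sum_Ioo_inv_sq_le n M))
  rw [abs_div, abs_mul, Nat.abs_cast, div_eq_mul_inv, sq, mul_inv]
  gcongr
  exact (mul_le_of_le_one_left (abs_nonneg _) (abs_moebius_cast_le_one k)).trans
    (abs_invCoprime_le m k)

/-- The denominators `q ≤ Q` with `q ≡ b (mod m)` of the fractions in `𝔉_Q^{(m,b)}`. -/
def denoms (m : ℕ) (b : ℤ) (Q : ℕ) : Finset ℕ :=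
  {q ∈ Finset.Icc 1 Q | ((q : ℕ) : ℤ) ≡ b [ZMOD m]}

section Denominators

variable {m : ℕ} {b : ℤ} {Q n q : ℕ}

lemma mem_denoms : q ∈ denoms m b Q ↔ (0 < q ∧ q ≤ Q) ∧ (q : ℤ) ≡ b [ZMOD m] := by
  rw [denoms, Finset.mem_filter, Finset.mem_Icc, Nat.succ_le_iff]

lemma coprime_of_mem_denoms (hb : IsCoprime b (m : ℤ)) (h : q ∈ denoms m b Q) : q.Coprime m :=
  coprime_of_mul_modEq hb (l := 1) (by simpa using (mem_denoms.1 h).2)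

lemma abs_card_filter_dvd_denoms_sub_le (hm : 0 < m) (hb : IsCoprime b (m : ℤ)) (hn : 0 < n)
    {k : ℕ} (hk : 0 < k) :
    |(#{q ∈ denoms m b n | k ∣ q} : ℝ) - n / m * invCoprime m k| ≤ 3 := by
  have hset : {q ∈ denoms m b n | k ∣ q} =
      {r ∈ Finset.Icc ⌈(1 : ℝ)⌉₊ ⌊(n : ℝ)⌋₊ | k ∣ r ∧ ((1 : ℕ) : ℤ) * (r : ℕ) ≡ b [ZMOD m]} := by
    ext q
    simp only [denoms, Finset.mem_filter, Nat.ceil_one, Nat.floor_natCast, Nat.cast_one, one_mul,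
      and_assoc, and_comm (a := k ∣ q)]
  rw [invCoprime_apply]
  split_ifs with hkm
  · have hcount := abs_card_filter_dvd_mul_modEq_sub_le hm b hk (by rwa [one_mul])
      zero_le_one (by exact_mod_cast hn : (1 : ℝ) ≤ n)
    have hkm1 : (1 : ℝ) ≤ k * m := by exact_mod_cast Nat.mul_pos hk hm
    have hinv : 1 / (k * m : ℝ) ≤ 1 := div_le_one_of_le₀ hkm1 (by positivity)
    have hinv0 : 0 ≤ 1 / (k * m : ℝ) := by positivity
    rw [← hset, sub_div, abs_le] at hcount
    rw [show (n : ℝ) / m * (k : ℝ)⁻¹ = n / (k * m) by field_simp, abs_le]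
    constructor <;> linarith
  · have hempty : {q ∈ denoms m b n | k ∣ q} = ∅ := by
      refine Finset.filter_eq_empty_iff.2 fun q hq ⟨s, hs⟩ => hkm ?_
      exact coprime_of_mul_modEq hb (l := s) (by exact_mod_cast hs ▸ (mem_denoms.1 hq).2)
    simp [hempty]

lemma abs_sum_totient_div_sub_le (hm : 0 < m) (hb : IsCoprime b (m : ℤ)) (n : ℕ) :
    |∑ q ∈ denoms m b n, (φ q : ℝ) / q - totientDensity m * n| ≤ 6 * √n := by
  rcases Nat.eq_zero_or_pos n with rfl | hn
  · simp [denoms]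
  have hm1 : (1 : ℝ) ≤ m := by exact_mod_cast hm
  have hterm : ∀ k ∈ Finset.Icc 1 n, |(μ k : ℝ) / k * #{q ∈ denoms m b n | k ∣ q} -
      (n / m : ℝ) * ((μ k : ℝ) * invCoprime m k / k)| ≤ 3 * (k : ℝ)⁻¹ := by
    intro k hk
    rw [show (μ k : ℝ) / k * #{q ∈ denoms m b n | k ∣ q} -
      (n / m : ℝ) * ((μ k : ℝ) * invCoprime m k / k) = (μ k : ℝ) *
        ((#{q ∈ denoms m b n | k ∣ q} - n / m * invCoprime m k) * (k : ℝ)⁻¹) by ring,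
      abs_mul, abs_mul, abs_inv, Nat.abs_cast]
    refine (mul_le_of_le_one_left (by positivity) (abs_moebius_cast_le_one k)).trans ?_
    gcongr
    exact abs_card_filter_dvd_denoms_sub_le hm hb hn (Finset.mem_Icc.1 hk).1
  have hcount : |∑ k ∈ Finset.Icc 1 n, (μ k : ℝ) / k * #{q ∈ denoms m b n | k ∣ q} -
      (n / m : ℝ) * ∑ k ∈ Finset.Icc 1 n, (μ k : ℝ) * invCoprime m k / k| ≤
      3 * (2 * √n - 1) := by
    rw [Finset.mul_sum, ← Finset.sum_sub_distrib]
    refine (Finset.abs_sum_le_sum_abs _ _).trans ((Finset.sum_le_sum hterm).trans ?_)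
    rw [← Finset.mul_sum]
    gcongr
    exact sum_Icc_inv_le_two_sqrt_sub_one hn
  have htail : |(n / m : ℝ) * ∑ k ∈ Finset.Icc 1 n, (μ k : ℝ) * invCoprime m k / k -
      totientDensity m * n| ≤ 2 := by
    rw [show totientDensity m * n = (n / m : ℝ) * (m * totientDensity m) by field_simp, ← mul_sub,
      abs_mul, abs_of_nonneg (by positivity)]
    calc (n / m : ℝ) * _ ≤ (n / 1) * (2 / (n + 1)) := by
          gcongr
          exact abs_sum_moebius_invCoprime_sub_le hm n
      _ ≤ 2 := by rw [div_one, mul_div_assoc', div_le_iff₀ (by positivity)]; linarith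
  rw [sum_totient_div_eq_sum_moebius_mul_card (S := denoms m b n) (Finset.filter_subset _ _)]
  linarith [abs_sub_le _ _ _ |>.trans (add_le_add hcount htail)]

lemma abs_sum_mul_monotone_le {c f : ℕ → ℝ} {E : ℝ} {n : ℕ}
    (hc : ∀ k ≤ n, |∑ q ∈ Finset.Icc 1 k, c q| ≤ E) (hf : Monotone f) (hf0 : 0 ≤ f 0) :
    |∑ q ∈ Finset.Icc 1 n, c q * f q| ≤ 2 * E * f n := by
  have hE : 0 ≤ E := (abs_nonneg _).trans (hc 0 (Nat.zero_le _))
  have key : ∀ k ≤ n, |∑ q ∈ Finset.Icc 1 k, c q * f q - (∑ q ∈ Finset.Icc 1 k, c q) * f k| ≤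
      E * (f k - f 0) := by
    intro k
    induction k with
    | zero => simp
    | succ k ih =>
      intro hk
      rw [Finset.sum_Icc_succ_top (by omega), Finset.sum_Icc_succ_top (by omega)]
      set S := ∑ q ∈ Finset.Icc 1 k, c q
      set R := ∑ q ∈ Finset.Icc 1 k, c q * f q
      calc |R + c (k + 1) * f (k + 1) - (S + c (k + 1)) * f (k + 1)|
          = |(R - S * f k) + S * (f k - f (k + 1))| := by ring_nf
        _ ≤ |R - S * f k| + |S| * (f (k + 1) - f k) := by
          refine (abs_add_le _ _).trans_eq ?_
          rw [abs_mul, abs_sub_comm (f k), abs_of_nonneg (sub_nonneg.2 (hf k.le_succ))]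
        _ ≤ E * (f k - f 0) + E * (f (k + 1) - f k) :=
          add_le_add (ih (by omega))
            (mul_le_mul_of_nonneg_right (hc k (by omega)) (sub_nonneg.2 (hf k.le_succ)))
        _ = E * (f (k + 1) - f 0) := by ring
  have htop : |(∑ q ∈ Finset.Icc 1 n, c q) * f n| ≤ E * f n := by
    have hfn : 0 ≤ f n := hf0.trans (hf n.zero_le)
    rw [abs_mul, abs_of_nonneg hfn]
    exact mul_le_mul_of_nonneg_right (hc n le_rfl) hfn
  have htri := abs_add_le (∑ q ∈ Finset.Icc 1 n, c q * f q - (∑ q ∈ Finset.Icc 1 n, c q) * f n)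
    ((∑ q ∈ Finset.Icc 1 n, c q) * f n)
  rw [sub_add_cancel] at htri
  linarith [key n le_rfl, mul_nonneg hE hf0]

lemma abs_sum_sub_integral_le {f : ℝ → ℝ} (hf : Monotone f) (hf0 : 0 ≤ f 0) (n : ℕ) :
    |∑ q ∈ Finset.Icc 1 n, f q - ∫ x in (0 : ℝ)..n, f x| ≤ f n := by
  have hlower := (hf.monotoneOn (Set.Icc (0 : ℝ) (0 + n))).sum_le_integral
  have hupper := (hf.monotoneOn (Set.Icc (0 : ℝ) (0 + n))).integral_le_sum
  simp only [zero_add] at hlower hupper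
  have hshift : ∑ q ∈ Finset.Icc 1 n, f q = ∑ i ∈ Finset.range n, f ((i + 1 : ℕ) : ℝ) := by
    rw [Finset.range_eq_Ico, Finset.sum_Ico_add' (fun i : ℕ => f (i : ℝ)) 0 n 1]
    rfl
  have htelescope : ∑ i ∈ Finset.range n, f ((i + 1 : ℕ) : ℝ) + f 0 =
      ∑ i ∈ Finset.range n, f (i : ℝ) + f n := by
    have h := Finset.sum_range_succ' (fun i : ℕ => f (i : ℝ)) n
    rwa [Finset.sum_range_succ, Nat.cast_zero, eq_comm] at h
  rw [hshift, abs_le]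
  constructor <;> linarith [hf (Nat.cast_nonneg n)]

lemma abs_sum_totient_div_mul_sub_le (hm : 0 < m) (hb : IsCoprime b (m : ℤ))
    {f : ℝ → ℝ} (hf : Monotone f) (hf0 : 0 ≤ f 0) (n : ℕ) :
    |∑ q ∈ denoms m b n, (φ q : ℝ) / q * f q - totientDensity m * ∫ x in (0 : ℝ)..n, f x| ≤
      (12 * √n + totientDensity m) * f n := by
  set A := totientDensity m
  have hA : 0 < A := totientDensity_pos hm
  set w : ℕ → ℝ := fun q => if (q : ℤ) ≡ b [ZMOD m] then (φ q : ℝ) / q else 0 with hw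
  have hpartial : ∀ k ≤ n, |∑ q ∈ Finset.Icc 1 k, (w q - A)| ≤ 6 * √n := by
    intro k hk
    have hsum : ∑ q ∈ Finset.Icc 1 k, (w q - A) = ∑ q ∈ denoms m b k, (φ q : ℝ) / q - A * k := by
      rw [Finset.sum_sub_distrib, ← Finset.sum_filter, denoms, Finset.sum_const, Nat.card_Icc,
        nsmul_eq_mul, add_tsub_cancel_right, mul_comm A]
    rw [hsum]
    exact (abs_sum_totient_div_sub_le hm hb k).trans (by gcongr)
  have hfluct := abs_sum_mul_monotone_le hpartial (hf.comp Nat.mono_cast) (by simpa using hf0)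
  have hmain := mul_le_mul_of_nonneg_left (abs_sum_sub_integral_le hf hf0 n) hA.le
  rw [← abs_of_pos hA, ← abs_mul, abs_of_pos hA] at hmain
  have hsplit : ∑ q ∈ denoms m b n, (φ q : ℝ) / q * f q =
      ∑ q ∈ Finset.Icc 1 n, (w q - A) * f q + A * ∑ q ∈ Finset.Icc 1 n, f q := by
    rw [Finset.mul_sum, ← Finset.sum_add_distrib, denoms, Finset.sum_filter]
    refine Finset.sum_congr rfl fun q _ => ?_
    simp only [hw]
    split_ifs <;> ring
  rw [hsplit, add_sub_assoc, ← mul_sub]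
  refine (abs_add_le _ _).trans ((add_le_add hfluct hmain).trans_eq ?_)
  simp only [Function.comp_apply]
  ring

lemma abs_sum_totient_sub_le (hm : 0 < m) (hb : IsCoprime b (m : ℤ)) (n : ℕ) :
    |∑ q ∈ denoms m b n, (φ q : ℝ) - totientDensity m * n ^ 2 / 2| ≤
      (12 * √n + totientDensity m) * n := by
  have h := abs_sum_totient_div_mul_sub_le hm hb (f := id) monotone_id le_rfl n
  have hsum : ∑ q ∈ denoms m b n, (φ q : ℝ) / q * id (q : ℝ) = ∑ q ∈ denoms m b n, (φ q : ℝ) :=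
    Finset.sum_congr rfl fun q hq =>
      div_mul_cancel₀ _ (by exact_mod_cast (mem_denoms.1 hq).1.1.ne')
  rw [hsum] at h
  simp only [id_eq, integral_id] at h
  convert h using 3
  ring

end Denominators

/-! ### Linear congruences in reduced residues -/

lemma card_filter_unitsMap_mul_totient {n q : ℕ} [NeZero q] [NeZero n] (h : n ∣ q)
    (v : (ZMod n)ˣ) : #{u : (ZMod q)ˣ | ZMod.unitsMap h u = v} * φ n = φ q := by
  have hfiber : ∀ w ∈ (Finset.univ : Finset (ZMod n)ˣ),
      #{u : (ZMod q)ˣ | ZMod.unitsMap h u = w} = #{u : (ZMod q)ˣ | ZMod.unitsMap h u = v} :=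
    fun w _ => MonoidHom.card_fiber_eq_of_mem_range _ (ZMod.unitsMap_surjective h w)
      (ZMod.unitsMap_surjective h v)
  rw [← ZMod.card_units_eq_totient q, ← ZMod.card_units_eq_totient n,
    ← Finset.card_univ (α := (ZMod q)ˣ), Finset.card_eq_sum_card_fiberwise
      (s := (Finset.univ : Finset (ZMod q)ˣ)) (t := Finset.univ) (f := ZMod.unitsMap h)
      fun _ _ => Finset.mem_coe.2 (Finset.mem_univ _),
    Finset.sum_congr rfl hfiber, Finset.sum_const, smul_eq_mul, mul_comm, Finset.card_univ]

lemma totient_mul_le_mul_totient (n d : ℕ) : φ (n * d) ≤ d * φ n := by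
  rw [mul_comm n]
  induction d using induction_on_primes with
  | zero => simp
  | one => simp
  | prime_mul p d hp ih =>
    rw [mul_assoc, mul_assoc]
    by_cases h : p ∣ d * n
    · rw [Nat.totient_mul_of_prime_of_dvd hp h]
      exact Nat.mul_le_mul_left p ih
    · rw [Nat.totient_mul_of_prime_of_not_dvd hp h]
      exact Nat.mul_le_mul (Nat.sub_le p 1) ih

/-- The number of reduced residues `a` modulo `q` with `a * r + D ≡ 0 (mod q)`. -/
def solCount (q r D : ℕ) : ℕ := #{a ∈ Finset.Icc 1 q | a.Coprime q ∧ q ∣ a * r + D}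

lemma exists_natCast_eq_of_zmod {q : ℕ} [NeZero q] (x : ZMod q) :
    ∃ a ∈ Finset.Icc 1 q, (a : ZMod q) = x := by
  rcases Nat.eq_zero_or_pos x.val with h | h
  · exact ⟨q, Finset.right_mem_Icc.2 (NeZero.pos q),
      by rw [ZMod.natCast_self, eq_comm, ← ZMod.val_eq_zero, h]⟩
  · exact ⟨x.val, Finset.mem_Icc.2 ⟨h, (ZMod.val_lt x).le⟩, ZMod.natCast_zmod_val x⟩

lemma natCast_mul_add_eq_zero_iff {q a r D : ℕ} :
    (a : ZMod q) * r + D = 0 ↔ q ∣ a * r + D := by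
  rw [← ZMod.natCast_eq_zero_iff, Nat.cast_add, Nat.cast_mul]

lemma solCount_eq_card_units {q : ℕ} [NeZero q] (r D : ℕ) :
    solCount q r D = #{u : (ZMod q)ˣ | (u : ZMod q) * r + D = 0} := by
  refine Finset.card_bij (fun a ha => ZMod.unitOfCoprime a (Finset.mem_filter.1 ha).2.1) ?_ ?_ ?_
  · intro a ha
    simpa [natCast_mul_add_eq_zero_iff] using (Finset.mem_filter.1 ha).2.2
  · intro a ha a' ha' haa
    have hmod := congrArg (fun u : (ZMod q)ˣ => (u : ZMod q)) haa
    simp only [ZMod.coe_unitOfCoprime, ZMod.natCast_eq_natCast_iff] at hmod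
    have h := Finset.mem_Icc.1 (Finset.mem_filter.1 ha).1
    have h' := Finset.mem_Icc.1 (Finset.mem_filter.1 ha').1
    have := Int.eq_zero_of_abs_lt_dvd (Nat.modEq_iff_dvd.1 hmod) (by rw [abs_lt]; omega)
    omega
  · intro u hu
    obtain ⟨a, ha, hau⟩ := exists_natCast_eq_of_zmod (u : ZMod q)
    have hdvd : q ∣ a * r + D := by
      rw [← natCast_mul_add_eq_zero_iff, hau]
      exact (Finset.mem_filter.1 hu).2
    exact ⟨a, Finset.mem_filter.2 ⟨ha, (ZMod.isUnit_iff_coprime a q).1 (hau ▸ u.isUnit), hdvd⟩,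
      Units.ext hau⟩

lemma gcd_eq_gcd_of_dvd_mul_add {a q r D : ℕ} (ha : a.Coprime q) (h : q ∣ a * r + D) :
    r.gcd q = D.gcd q := by
  rw [← Nat.Coprime.gcd_mul_left_cancel r ha]
  exact Nat.dvd_antisymm
    (Nat.dvd_gcd ((Nat.dvd_add_right (Nat.gcd_dvd_left _ _)).1 ((Nat.gcd_dvd_right _ _).trans h))
      (Nat.gcd_dvd_right _ _))
    (Nat.dvd_gcd ((Nat.dvd_add_left (Nat.gcd_dvd_left _ _)).1 ((Nat.gcd_dvd_right _ _).trans h))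
      (Nat.gcd_dvd_right _ _))

lemma solCount_eq_zero {q r D : ℕ} (h : r.gcd q ≠ D.gcd q) : solCount q r D = 0 :=
  Finset.card_eq_zero.2 (Finset.filter_eq_empty_iff.2
    fun _ _ ha => h (gcd_eq_gcd_of_dvd_mul_add ha.1 ha.2))

lemma solCount_mul_totient {n d r D : ℕ} (hn : 0 < n) (hd : 0 < d) (hr : r.Coprime n)
    (hD : D.Coprime n) : solCount (n * d) (r * d) (D * d) * φ n = φ (n * d) := by
  have : NeZero n := ⟨hn.ne'⟩
  have : NeZero (n * d) := ⟨(Nat.mul_pos hn hd).ne'⟩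
  have hnd : n ∣ n * d := dvd_mul_right n d
  rw [solCount_eq_card_units, ← card_filter_unitsMap_mul_totient hnd
    (-ZMod.unitOfCoprime D hD * (ZMod.unitOfCoprime r hr)⁻¹)]
  congr 2
  refine Finset.filter_congr fun u _ => ?_
  obtain ⟨a, -, hau⟩ := exists_natCast_eq_of_zmod (u : ZMod (n * d))
  rw [eq_mul_inv_iff_mul_eq, ← Units.val_inj]
  simp only [Units.val_mul, Units.val_neg, ZMod.coe_unitOfCoprime, ZMod.unitsMap_val]
  rw [← hau, ZMod.cast_natCast hnd, eq_neg_iff_add_eq_zero, natCast_mul_add_eq_zero_iff,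
    natCast_mul_add_eq_zero_iff, ← mul_assoc, ← add_mul]
  exact Nat.mul_dvd_mul_iff_right hd

lemma sum_divisors_filter_dvd_moebius {n : ℕ} (hn : n ≠ 0) (r : ℕ) :
    ∑ f ∈ n.divisors with f ∣ r, (μ f : ℝ) = if r.Coprime n then 1 else 0 := by
  have hset : {f ∈ n.divisors | f ∣ r} = (r.gcd n).divisors := by
    ext f
    have := Nat.gcd_ne_zero_right (m := r) hn
    simp only [Finset.mem_filter, Nat.mem_divisors, Nat.dvd_gcd_iff]
    tauto
  rw [hset, sum_divisors_moebius]

lemma solCount_eq_sum_moebius {n d D : ℕ} (hn : 0 < n) (hd : 0 < d) (hD : D.Coprime n) (r : ℕ) :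
    (solCount (n * d) r (D * d) : ℝ) =
      φ (n * d) / φ n * ∑ f ∈ n.divisors with f * d ∣ r, (μ f : ℝ) := by
  have hφ : (φ n : ℝ) ≠ 0 := by exact_mod_cast (Nat.totient_pos.2 hn).ne'
  have hgcd : (D * d).gcd (n * d) = d := by rw [Nat.gcd_mul_right, hD, one_mul]
  by_cases hdr : d ∣ r
  · obtain ⟨s, rfl⟩ := hdr
    rw [mul_comm d s]
    simp only [Nat.mul_dvd_mul_iff_right hd]
    rw [sum_divisors_filter_dvd_moebius hn.ne' s]
    split_ifs with hs
    · rw [mul_one, eq_div_iff hφ]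
      exact_mod_cast solCount_mul_totient hn hd hs hD
    · rw [solCount_eq_zero, Nat.cast_zero, mul_zero]
      rw [hgcd, Nat.gcd_mul_right]
      exact fun h => hs (Nat.eq_of_mul_eq_mul_right hd (by rw [h, one_mul]))
  · rw [solCount_eq_zero, Finset.filter_false_of_mem fun f _ h => hdr (dvd_of_mul_left_dvd h),
      Finset.sum_empty, mul_zero, Nat.cast_zero]
    exact fun h => hdr (hgcd ▸ h ▸ Nat.gcd_dvd_left r (n * d))

lemma sum_solCount_eq_sum_moebius_mul_card {n d D : ℕ} (hn : 0 < n) (hd : 0 < d)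
    (hD : D.Coprime n) (S : Finset ℕ) :
    ∑ r ∈ S, (solCount (n * d) r (D * d) : ℝ) =
      φ (n * d) / φ n * ∑ f ∈ n.divisors, (μ f : ℝ) * #{r ∈ S | f * d ∣ r} := by
  simp_rw [solCount_eq_sum_moebius hn hd hD, ← Finset.mul_sum, Finset.sum_filter]
  rw [Finset.sum_comm]
  congr 1
  refine Finset.sum_congr rfl fun f _ => ?_
  rw [← Finset.sum_filter, Finset.sum_const, nsmul_eq_mul, mul_comm]

lemma abs_sum_moebius_mul_card_sub_le {m : ℕ} (hm : 0 < m) (b : ℤ) {e n d : ℕ} (he : e.Coprime m)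
    (hn : 0 < n) (hd : 0 < d) (hnd : (n * d).Coprime m) {α β : ℝ} (h0 : 0 ≤ α) (hαβ : α ≤ β) :
    |∑ f ∈ n.divisors, (μ f : ℝ) *
        #{r ∈ {r ∈ Finset.Icc ⌈α⌉₊ ⌊β⌋₊ | (e : ℤ) * (r : ℕ) ≡ b [ZMOD m]} | f * d ∣ r} -
      (β - α) / (d * m) * (φ n / n)| ≤ 4 * √n := by
  have hmain : (β - α) / (d * m) * (φ n / n) =
      ∑ f ∈ n.divisors, (μ f : ℝ) * ((β - α) / ((f * d : ℕ) * m)) := by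
    rw [totient_div_self_eq_sum hn.ne', Finset.mul_sum]
    refine Finset.sum_congr rfl fun f _ => ?_
    push_cast
    ring
  have hterm : ∀ f ∈ n.divisors, |(μ f : ℝ) *
      #{r ∈ {r ∈ Finset.Icc ⌈α⌉₊ ⌊β⌋₊ | (e : ℤ) * (r : ℕ) ≡ b [ZMOD m]} | f * d ∣ r} -
        (μ f : ℝ) * ((β - α) / ((f * d : ℕ) * m))| ≤ 2 := by
    intro f hf
    have hfm : (e * (f * d)).Coprime m := he.mul_left
      (hnd.coprime_dvd_left (Nat.mul_dvd_mul_right (Nat.dvd_of_mem_divisors hf) d))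
    rw [Finset.filter_filter, ← mul_sub, abs_mul]
    simp only [and_comm (b := f * d ∣ _)]
    exact (mul_le_of_le_one_left (abs_nonneg _) (abs_moebius_cast_le_one f)).trans
      (abs_card_filter_dvd_mul_modEq_sub_le hm b (Nat.mul_pos (Nat.pos_of_mem_divisors hf) hd)
        hfm h0 hαβ)
  rw [hmain, ← Finset.sum_sub_distrib]
  calc _ ≤ #n.divisors • (2 : ℝ) :=
        (Finset.abs_sum_le_sum_abs _ _).trans (Finset.sum_le_card_nsmul _ _ _ hterm)
    _ ≤ 2 * √n * 2 := by rw [nsmul_eq_mul]; gcongr; exact card_divisors_le_two_sqrt n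
    _ = 4 * √n := by ring

lemma abs_sum_solCount_sub_le {m : ℕ} (hm : 0 < m) (b : ℤ) {e q D : ℕ} (he : e.Coprime m)
    (hq : 0 < q) (hqm : q.Coprime m) (hD : 0 < D) {α β : ℝ} (h0 : 0 ≤ α) (hαβ : α ≤ β) :
    |∑ r ∈ Finset.Icc ⌈α⌉₊ ⌊β⌋₊ with (e : ℤ) * (r : ℕ) ≡ b [ZMOD m], (solCount q r D : ℝ) -
      (β - α) / m * (φ q / q)| ≤ 4 * D * √q := by
  obtain ⟨d, D, n, hd, hcop, rfl, rfl⟩ := Nat.exists_coprime' (Nat.gcd_pos_of_pos_right D hq)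
  have hn : 0 < n := Nat.pos_of_mul_pos_right hq
  have hD : 0 < D := Nat.pos_of_mul_pos_right hD
  have hφ : (0 : ℝ) < φ n := by exact_mod_cast Nat.totient_pos.2 hn
  have hκ : (φ (n * d) : ℝ) / φ n ≤ D * d := by
    rw [div_le_iff₀ hφ]
    exact_mod_cast (totient_mul_le_mul_totient n d).trans
      (Nat.mul_le_mul_right _ (Nat.le_mul_of_pos_left d hD))
  have hmain : (β - α) / m * (φ (n * d) / (n * d : ℕ)) =
      φ (n * d) / φ n * ((β - α) / (d * m) * (φ n / n)) := by
    push_cast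
    field_simp
  rw [sum_solCount_eq_sum_moebius_mul_card hn hd hcop, hmain, ← mul_sub, abs_mul,
    abs_of_nonneg (by positivity)]
  calc _ ≤ (D * d : ℝ) * (4 * √n) := by
        gcongr
        exact abs_sum_moebius_mul_card_sub_le hm b he hn hd hqm h0 hαβ
    _ ≤ (D * d : ℝ) * (4 * √(n * d : ℕ)) := by
        gcongr
        exact Nat.le_mul_of_pos_right n hd
    _ = 4 * (D * d : ℕ) * √(n * d : ℕ) := by push_cast; ring

/-! ### Pairs of Farey fractions -/

/-- The number of reduced residues `a` modulo `q` such that `a / q + Δ / (q * q')` is a reduced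
fraction of denominator `q'`, that is, of pairs `(a, a')` with `a' * q - a * q' = Δ` and with
`a / q` and `a' / q'` reduced. -/
def pairCount (q q' Δ : ℕ) : ℕ :=
  #{a ∈ Finset.Icc 1 q | a.Coprime q ∧ q ∣ a * q' + Δ ∧ ((a * q' + Δ) / q).Coprime q'}

lemma sum_divisors_moebius_of_mul_add_eq {a a' q q' Δ : ℕ} (hΔ : Δ ≠ 0)
    (h : a * q' + Δ = q * a') :
    ∑ e ∈ Δ.divisors with e ∣ q' ∧ e ∣ a', (μ e : ℝ) = if a'.Coprime q' then 1 else 0 := by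
  have ha' : a' ≠ 0 := by
    rintro rfl
    omega
  have hset : {e ∈ Δ.divisors | e ∣ q' ∧ e ∣ a'} = (a'.gcd q').divisors := by
    ext e
    simp only [Finset.mem_filter, Nat.mem_divisors, Nat.dvd_gcd_iff]
    constructor
    · exact fun he => ⟨⟨he.2.2, he.2.1⟩, Nat.gcd_ne_zero_left ha'⟩
    · rintro ⟨⟨hea', heq'⟩, -⟩
      exact ⟨⟨(Nat.dvd_add_right (heq'.mul_left a)).1 (h ▸ hea'.mul_left q), hΔ⟩, heq', hea'⟩
  rw [hset, sum_divisors_moebius]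

lemma dvd_mul_and_dvd_mul_div_iff {e q x : ℕ} (he : 0 < e) (hq : 0 < q) :
    q ∣ e * x ∧ e ∣ e * x / q ↔ q ∣ x := by
  constructor
  · rintro ⟨⟨c, hc⟩, h⟩
    rw [hc, Nat.mul_div_cancel_left _ hq] at h
    obtain ⟨c', rfl⟩ := h
    exact ⟨c', Nat.eq_of_mul_eq_mul_left he (by rw [hc]; ring)⟩
  · rintro ⟨c, rfl⟩
    rw [mul_left_comm, Nat.mul_div_cancel_left _ hq]
    exact ⟨dvd_mul_right _ _, dvd_mul_right _ _⟩

lemma pairCount_eq_sum {q Δ : ℕ} (q' : ℕ) (hq : 0 < q) (hΔ : 0 < Δ) :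
    (pairCount q q' Δ : ℝ) =
      ∑ e ∈ Δ.divisors with e ∣ q', (μ e : ℝ) * solCount q (q' / e) (Δ / e) := by
  set S : Finset ℕ := {a ∈ Finset.Icc 1 q | a.Coprime q ∧ q ∣ a * q' + Δ} with hS
  have hind : ∀ a ∈ S, (if ((a * q' + Δ) / q).Coprime q' then (1 : ℝ) else 0) =
      ∑ e ∈ Δ.divisors with e ∣ q', if e ∣ (a * q' + Δ) / q then (μ e : ℝ) else 0 := by
    intro a ha
    rw [← sum_divisors_moebius_of_mul_add_eq hΔ.ne'
      (Nat.mul_div_cancel' (Finset.mem_filter.1 ha).2.2).symm, ← Finset.sum_filter,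
      Finset.filter_filter]
  have hcount : (pairCount q q' Δ : ℝ) =
      ∑ a ∈ S, if ((a * q' + Δ) / q).Coprime q' then (1 : ℝ) else 0 := by
    simp only [pairCount, hS, Finset.sum_boole, Finset.filter_filter, and_assoc]
  rw [hcount, Finset.sum_congr rfl hind, Finset.sum_comm]
  refine Finset.sum_congr rfl fun e he => ?_
  obtain ⟨⟨⟨D, rfl⟩, -⟩, ⟨r, rfl⟩⟩ : (e ∣ Δ ∧ Δ ≠ 0) ∧ e ∣ q' := by
    simpa only [Finset.mem_filter, Nat.mem_divisors] using he
  have he0 : 0 < e := Nat.pos_of_mul_pos_right hΔ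
  rw [Nat.mul_div_cancel_left _ he0, Nat.mul_div_cancel_left _ he0, ← Finset.sum_filter,
    Finset.sum_const, nsmul_eq_mul, mul_comm, hS, Finset.filter_filter, solCount]
  simp only [and_assoc, mul_left_comm _ e r, ← mul_add, dvd_mul_and_dvd_mul_div_iff he0 hq]

section

variable {m : ℕ} {b : ℤ} {Q : ℕ} {α : ℝ}

lemma sum_denoms_filter_dvd {M : Type*} [AddCommMonoid M] (hα : 0 < α) {e : ℕ} (he : 0 < e)
    (g : ℕ → M) :
    ∑ q ∈ denoms m b Q with α ≤ (q : ℕ) ∧ e ∣ q, g q =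
      ∑ r ∈ Finset.Icc ⌈α / e⌉₊ ⌊(Q : ℝ) / e⌋₊ with (e : ℤ) * (r : ℕ) ≡ b [ZMOD m],
        g (e * r) := by
  have he' : (0 : ℝ) < e := by exact_mod_cast he
  have hmem : ∀ r : ℕ, r ∈ Finset.Icc ⌈α / e⌉₊ ⌊(Q : ℝ) / e⌋₊ ↔
      α ≤ (e * r : ℕ) ∧ e * r ≤ Q := by
    intro r
    rw [Finset.mem_Icc, Nat.ceil_le, Nat.le_floor_iff (by positivity), div_le_iff₀' he',
      le_div_iff₀' he']
    norm_cast
  have himage : {q ∈ denoms m b Q | α ≤ (q : ℕ) ∧ e ∣ q} =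
      {r ∈ Finset.Icc ⌈α / e⌉₊ ⌊(Q : ℝ) / e⌋₊ | (e : ℤ) * (r : ℕ) ≡ b [ZMOD m]}.image
        (e * ·) := by
    ext q
    simp only [Finset.mem_filter, Finset.mem_image, hmem, mem_denoms]
    constructor
    · rintro ⟨⟨⟨-, hQ⟩, hb⟩, hαq, r, rfl⟩
      exact ⟨r, ⟨⟨hαq, hQ⟩, by exact_mod_cast hb⟩, rfl⟩
    · rintro ⟨r, ⟨⟨hαr, hQ⟩, hb⟩, rfl⟩
      exact ⟨⟨⟨by exact_mod_cast hα.trans_le hαr, hQ⟩, by exact_mod_cast hb⟩, hαr,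
        dvd_mul_right e r⟩
  rw [himage, Finset.sum_image fun _ _ _ _ => Nat.eq_of_mul_eq_mul_left he]

lemma sum_pairCount_eq {q Δ : ℕ} (hq : 0 < q) (hΔ : 0 < Δ) (hα : 0 < α) :
    ∑ q' ∈ denoms m b Q with α ≤ (q' : ℕ), (pairCount q q' Δ : ℝ) =
      ∑ e ∈ Δ.divisors, (μ e : ℝ) *
        ∑ r ∈ Finset.Icc ⌈α / e⌉₊ ⌊(Q : ℝ) / e⌋₊ with (e : ℤ) * (r : ℕ) ≡ b [ZMOD m],
          (solCount q r (Δ / e) : ℝ) := by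
  simp_rw [pairCount_eq_sum _ hq hΔ, Finset.sum_filter (fun e => e ∣ _)]
  rw [Finset.sum_comm]
  refine Finset.sum_congr rfl fun e he => ?_
  have he0 := Nat.pos_of_mem_divisors he
  rw [← Finset.sum_filter, Finset.filter_filter, ← Finset.mul_sum,
    sum_denoms_filter_dvd hα he0 fun q' => (solCount q (q' / e) (Δ / e) : ℝ)]
  simp only [Nat.mul_div_cancel_left _ he0]

/-- The coefficient `∑ μ(e) / e` over the divisors `e` of `Δ` prime to `m`, which is the weight of
the determinant `Δ` in the pair correlation function. -/
noncomputable def pairWeight (m Δ : ℕ) : ℝ := ∑ e ∈ Δ.divisors, (μ e : ℝ) * invCoprime m e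

lemma abs_sum_solCount_div_sub_le (hm : 0 < m) (hb : IsCoprime b (m : ℤ)) {q Δ e : ℕ}
    (hq : 0 < q) (hqm : q.Coprime m) (he : e ∈ Δ.divisors) (hα : 0 ≤ α) (hαQ : α ≤ Q) :
    |∑ r ∈ Finset.Icc ⌈α / e⌉₊ ⌊(Q : ℝ) / e⌋₊ with (e : ℤ) * (r : ℕ) ≡ b [ZMOD m],
      (solCount q r (Δ / e) : ℝ) - invCoprime m e * ((Q - α) / m * (φ q / q))| ≤
      4 * Δ * √q := by
  rw [invCoprime_apply]
  split_ifs with hem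
  · have hD : 0 < Δ / e := Nat.div_pos (Nat.divisor_le he) (Nat.pos_of_mem_divisors he)
    have hsum := abs_sum_solCount_sub_le hm b hem hq hqm hD (α := α / e) (β := Q / e)
      (by positivity) (by gcongr)
    rw [show ((Q : ℝ) / e - α / e) / m * (φ q / q) =
      (e : ℝ)⁻¹ * ((Q - α) / m * (φ q / q)) by ring] at hsum
    refine hsum.trans ?_
    gcongr
    exact Nat.div_le_self Δ e
  · rw [Finset.filter_false_of_mem fun r _ hr => hem (coprime_of_mul_modEq hb hr),
      Finset.sum_empty, zero_mul, sub_zero, abs_zero]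
    positivity

lemma abs_sum_pairCount_sub_le (hm : 0 < m) (hb : IsCoprime b (m : ℤ)) {q Δ : ℕ} (hq : 0 < q)
    (hqm : q.Coprime m) (hΔ : 0 < Δ) (hα : 0 < α) (hαQ : α ≤ Q) :
    |∑ q' ∈ denoms m b Q with α ≤ (q' : ℕ), (pairCount q q' Δ : ℝ) -
      pairWeight m Δ * ((Q - α) / m * (φ q / q))| ≤ 4 * Δ ^ 2 * √q := by
  rw [sum_pairCount_eq hq hΔ hα, pairWeight, Finset.sum_mul, ← Finset.sum_sub_distrib]
  have hterm : ∀ e ∈ Δ.divisors, |(μ e : ℝ) *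
      ∑ r ∈ Finset.Icc ⌈α / e⌉₊ ⌊(Q : ℝ) / e⌋₊ with (e : ℤ) * (r : ℕ) ≡ b [ZMOD m],
        (solCount q r (Δ / e) : ℝ) - (μ e : ℝ) * invCoprime m e * ((Q - α) / m * (φ q / q))| ≤
      4 * Δ * √q := by
    intro e he
    rw [mul_assoc, ← mul_sub, abs_mul]
    exact (mul_le_of_le_one_left (abs_nonneg _) (abs_moebius_cast_le_one e)).trans
      (abs_sum_solCount_div_sub_le hm hb hq hqm he hα.le hαQ)
  refine (Finset.abs_sum_le_sum_abs _ _).trans ((Finset.sum_le_card_nsmul _ _ _ hterm).trans ?_)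
  rw [nsmul_eq_mul]
  calc (#Δ.divisors : ℝ) * (4 * Δ * √q) ≤ Δ * (4 * Δ * √q) := by
        gcongr
        exact Nat.card_divisors_le_self Δ
    _ = 4 * Δ ^ 2 * √q := by ring

end

lemma eq_and_eq_of_div_eq_div {a q c d : ℕ} (hq : 0 < q) (hd : 0 < d) (haq : a.Coprime q)
    (hcd : c.Coprime d) (h : (a : ℝ) / q = c / d) : a = c ∧ q = d := by
  have h' : ((a : ℤ) : ℚ) / (q : ℤ) = (c : ℤ) / (d : ℤ) := by
    simpa only [Int.cast_natCast, ← Rat.cast_inj (α := ℝ), Rat.cast_div, Rat.cast_natCast] using h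
  have hinj := Rat.div_int_inj (a := a) (b := q) (c := c) (d := d) (by exact_mod_cast hq)
    (by exact_mod_cast hd) (by simpa only [Int.natAbs_natCast] using haq)
    (by simpa only [Int.natAbs_natCast] using hcd) h'
  exact_mod_cast hinj

lemma div_sub_div_eq_of_mul_add_eq {a q a' q' Δ : ℕ} (hq : 0 < q) (hq' : 0 < q')
    (h : a * q' + Δ = q * a') : (a' : ℝ) / q' - (a : ℝ) / q = Δ / (q * q') := by
  have h' : (a : ℝ) * q' + Δ = q * a' := by exact_mod_cast h
  have hq : (q : ℝ) ≠ 0 := by exact_mod_cast hq.ne'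
  have hq' : (q' : ℝ) ≠ 0 := by exact_mod_cast hq'.ne'
  rw [div_sub_div _ _ hq' hq, div_eq_div_iff (mul_ne_zero hq' hq) (mul_ne_zero hq hq')]
  linear_combination -(q * q') * h'

section

variable {m : ℕ} {b : ℤ} {Q : ℕ}

lemma mem_fareyMod {x : ℝ} :
    x ∈ fareyMod m b Q ↔
      ∃ a q : ℕ, a ∈ Finset.Icc 1 q ∧ q ∈ denoms m b Q ∧ a.Coprime q ∧ (a : ℝ) / q = x := by
  simp only [fareyMod, mem_denoms, Finset.mem_image, Finset.mem_filter, Finset.mem_product,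
    Finset.mem_Icc, Prod.exists]
  constructor
  · rintro ⟨a, q, ⟨⟨⟨ha, -⟩, hq⟩, haq, hcop, hmod⟩, hx⟩
    exact ⟨a, q, ⟨ha, haq⟩, ⟨hq, hmod⟩, hcop, hx⟩
  · rintro ⟨a, q, ⟨ha, haq⟩, ⟨hq, hmod⟩, hcop, hx⟩
    exact ⟨a, q, ⟨⟨⟨ha, haq.trans hq.2⟩, hq⟩, haq, hcop, hmod⟩, hx⟩

lemma card_filter_Icc_coprime (q : ℕ) : #{a ∈ Finset.Icc 1 q | a.Coprime q} = φ q := by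
  rw [← Nat.filter_coprime_Ico_eq_totient q 1, add_comm 1 q]
  simp only [Nat.coprime_comm]
  rfl

lemma card_fareyMod (m : ℕ) (b : ℤ) (Q : ℕ) : #(fareyMod m b Q) = ∑ q ∈ denoms m b Q, φ q := by
  have himage : fareyMod m b Q =
      ((denoms m b Q).sigma fun q => {a ∈ Finset.Icc 1 q | a.Coprime q}).image
        (fun p : (_ : ℕ) × ℕ => (p.2 : ℝ) / p.1) := by
    ext x
    rw [mem_fareyMod]
    simp only [Finset.mem_image, Finset.mem_sigma, Finset.mem_filter, Sigma.exists]
    constructor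
    · rintro ⟨a, q, ha, hq, hcop, hx⟩
      exact ⟨q, a, ⟨hq, ha, hcop⟩, hx⟩
    · rintro ⟨q, a, ⟨hq, ha, hcop⟩, hx⟩
      exact ⟨a, q, ha, hq, hcop, hx⟩
  rw [himage, Finset.card_image_of_injOn, Finset.card_sigma]
  · exact Finset.sum_congr rfl fun q _ => card_filter_Icc_coprime q
  · rintro ⟨q, a⟩ hp ⟨q', a'⟩ hp' h
    simp only [Finset.coe_sigma, Set.mem_sigma_iff, Finset.mem_coe, Finset.mem_filter,
      mem_denoms] at hp hp'
    obtain ⟨rfl, rfl⟩ := eq_and_eq_of_div_eq_div hp.1.1.1 hp'.1.1.1 hp.2.2 hp'.2.2 h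
    rfl

/-- The pair of fractions `(a / q, a' / q')`, with `a' = (a * q' + Δ) / q`, encoded by the quadruple
`(Δ, q, q', a)`. -/
noncomputable def fractionPair (t : (_ : ℕ) × (_ : ℕ) × (_ : ℕ) × ℕ) : ℝ × ℝ :=
  ((t.2.2.2 : ℝ) / t.2.1, (((t.2.2.2 * t.2.2.1 + t.1) / t.2.1 : ℕ) : ℝ) / t.2.2.1)

lemma fractionPair_eq {Δ q q' a a' : ℕ} (hq : 0 < q) (h : a * q' + Δ = q * a') :
    fractionPair ⟨Δ, q, q', a⟩ = ((a : ℝ) / q, (a' : ℝ) / q') := by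
  simp only [fractionPair, h, Nat.mul_div_cancel_left _ hq]

/-- The quadruples `(Δ, q, q', a)` with `Δ ≤ D` that encode the pairs `a / q < a' / q'` of Farey
fractions with `a' * q - a * q' = Δ` at distance `Δ / (q * q') ≤ ε`. -/
noncomputable def closeQuads (m : ℕ) (b : ℤ) (Q D : ℕ) (ε : ℝ) :
    Finset ((_ : ℕ) × (_ : ℕ) × (_ : ℕ) × ℕ) :=
  (Finset.Icc 1 D).sigma fun Δ => (denoms m b Q).sigma fun q =>
    {q' ∈ denoms m b Q | Δ / (ε * q) ≤ (q' : ℕ)}.sigma fun q' =>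
      {a ∈ Finset.Icc 1 q | a.Coprime q ∧ q ∣ a * q' + Δ ∧ ((a * q' + Δ) / q).Coprime q'}

lemma card_closeQuads (m : ℕ) (b : ℤ) (Q D : ℕ) (ε : ℝ) :
    #(closeQuads m b Q D ε) = ∑ Δ ∈ Finset.Icc 1 D, ∑ q ∈ denoms m b Q,
      ∑ q' ∈ denoms m b Q with Δ / (ε * q) ≤ (q' : ℕ), pairCount q q' Δ := by
  simp only [closeQuads, Finset.card_sigma, pairCount]

variable {D : ℕ} {ε : ℝ}

lemma mem_closeQuads (hε : 0 < ε) {Δ q q' a : ℕ} :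
    ⟨Δ, q, q', a⟩ ∈ closeQuads m b Q D ε ↔
      (0 < Δ ∧ Δ ≤ D) ∧ q ∈ denoms m b Q ∧ q' ∈ denoms m b Q ∧ (Δ : ℝ) / (q * q') ≤ ε ∧
        a ∈ Finset.Icc 1 q ∧ a.Coprime q ∧ ∃ a', a * q' + Δ = q * a' ∧ a'.Coprime q' := by
  have hpos : ∀ {r : ℕ}, r ∈ denoms m b Q → 0 < r := fun hr => (mem_denoms.1 hr).1.1
  have hle : q ∈ denoms m b Q → q' ∈ denoms m b Q →
      ((Δ : ℝ) / (ε * q) ≤ q' ↔ (Δ : ℝ) / (q * q') ≤ ε) := by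
    intro hq hq'
    have hq0 : (0 : ℝ) < q := by exact_mod_cast hpos hq
    have hq'0 : (0 : ℝ) < q' := by exact_mod_cast hpos hq'
    rw [div_le_iff₀ (by positivity), div_le_iff₀ (by positivity)]
    ring_nf
  have hdvd : q ∈ denoms m b Q → ((q ∣ a * q' + Δ ∧ ((a * q' + Δ) / q).Coprime q') ↔
      ∃ a', a * q' + Δ = q * a' ∧ a'.Coprime q') := by
    intro hq
    constructor
    · rintro ⟨hdvd, hcop⟩
      exact ⟨_, (Nat.mul_div_cancel' hdvd).symm, hcop⟩
    · rintro ⟨a', h, hcop⟩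
      rw [h, Nat.mul_div_cancel_left _ (hpos hq)]
      exact ⟨dvd_mul_right q a', hcop⟩
  simp only [closeQuads, Finset.mem_sigma, Finset.mem_filter, Finset.mem_Icc]
  grind

lemma injOn_fractionPair (hε : 0 < ε) :
    Set.InjOn fractionPair (closeQuads m b Q D ε) := by
  rintro ⟨Δ, q, q', a⟩ ht ⟨Δ', r, r', c⟩ hu h
  obtain ⟨-, hq, hq', -, -, hcop, a', ha', hcop'⟩ := (mem_closeQuads hε).1 (Finset.mem_coe.1 ht)
  obtain ⟨-, hr, hr', -, -, kcop, c', hc', kcop'⟩ := (mem_closeQuads hε).1 (Finset.mem_coe.1 hu)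
  rw [mem_denoms] at hq hq' hr hr'
  rw [fractionPair_eq hq.1.1 ha', fractionPair_eq hr.1.1 hc', Prod.mk.injEq] at h
  obtain ⟨rfl, rfl⟩ := eq_and_eq_of_div_eq_div hq.1.1 hr.1.1 hcop kcop h.1
  obtain ⟨rfl, rfl⟩ := eq_and_eq_of_div_eq_div hq'.1.1 hr'.1.1 hcop' kcop' h.2
  obtain rfl : Δ = Δ' := Nat.add_left_cancel (ha'.trans hc'.symm)
  rfl

lemma le_of_mul_add_eq_of_div_le (hεQ : ε * Q < 1) {a a' q q' Δ : ℕ} (hq : 0 < q)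
    (hq' : 0 < q') (hqQ : q' ≤ Q) (haq : a ≤ q) (h : a * q' + Δ = q * a')
    (hle : (Δ : ℝ) / (q * q') ≤ ε) : a' ≤ q' := by
  by_contra! hlt
  have : (0 : ℝ) < q := by exact_mod_cast hq
  have hq'0 : (0 : ℝ) < q' := by exact_mod_cast hq'
  have hΔ : (q : ℝ) ≤ Δ := by
    have : q ≤ Δ := by nlinarith
    exact_mod_cast this
  have hε : 1 / (q' : ℝ) ≤ ε := by
    calc 1 / (q' : ℝ) = q / (q * q') := by field_simp
      _ ≤ Δ / (q * q') := by gcongr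
      _ ≤ ε := hle
  have hqQ' : (q' : ℝ) ≤ Q := by exact_mod_cast hqQ
  have hε0 : 0 ≤ ε := hε.trans' (by positivity)
  have : 1 ≤ ε * Q := ((div_le_iff₀ hq'0).1 hε).trans (by gcongr)
  exact this.not_gt hεQ

lemma fractionPair_mem (hε : 0 < ε) (hεQ : ε * Q < 1)
    {t : (_ : ℕ) × (_ : ℕ) × (_ : ℕ) × ℕ} (ht : t ∈ closeQuads m b Q D ε) :
    (fractionPair t).1 ∈ fareyMod m b Q ∧ (fractionPair t).2 ∈ fareyMod m b Q ∧
      0 < (fractionPair t).2 - (fractionPair t).1 ∧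
      (fractionPair t).2 - (fractionPair t).1 ≤ ε := by
  obtain ⟨Δ, q, q', a⟩ := t
  obtain ⟨⟨hΔ, -⟩, hq, hq', hle, haq, hcop, a', h, hcop'⟩ := (mem_closeQuads hε).1 ht
  have hqpos := (mem_denoms.1 hq).1.1
  obtain ⟨hq'pos, hq'Q⟩ := (mem_denoms.1 hq').1
  have ha' : 1 ≤ a' := by
    rw [Nat.one_le_iff_ne_zero]
    rintro rfl
    omega
  have ha'q' := le_of_mul_add_eq_of_div_le hεQ hqpos hq'pos hq'Q (Finset.mem_Icc.1 haq).2 h hle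
  simp only [fractionPair_eq hqpos h, div_sub_div_eq_of_mul_add_eq hqpos hq'pos h]
  exact ⟨mem_fareyMod.2 ⟨a, q, haq, hq, hcop, rfl⟩,
    mem_fareyMod.2 ⟨a', q', Finset.mem_Icc.2 ⟨ha', ha'q'⟩, hq', hcop', rfl⟩, by positivity, hle⟩

lemma exists_fractionPair_eq (hε : 0 < ε) (hD : ε * Q ^ 2 ≤ D) {x y : ℝ}
    (hx : x ∈ fareyMod m b Q) (hy : y ∈ fareyMod m b Q) (hxy : 0 < y - x) (hle : y - x ≤ ε) :
    ∃ t ∈ closeQuads m b Q D ε, fractionPair t = (x, y) := by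
  obtain ⟨a, q, haq, hq, hcop, rfl⟩ := mem_fareyMod.1 hx
  obtain ⟨a', q', -, hq', hcop', rfl⟩ := mem_fareyMod.1 hy
  obtain ⟨hqpos, hqQ⟩ := (mem_denoms.1 hq).1
  obtain ⟨hq'pos, hq'Q⟩ := (mem_denoms.1 hq').1
  have hq0 : (0 : ℝ) < q := by exact_mod_cast hqpos
  have hq'0 : (0 : ℝ) < q' := by exact_mod_cast hq'pos
  obtain ⟨Δ, hΔ, h⟩ : ∃ Δ, 0 < Δ ∧ a * q' + Δ = q * a' := by
    have hlt : a * q' < q * a' := by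
      rw [sub_pos, div_lt_div_iff₀ hq0 hq'0, mul_comm (a' : ℝ)] at hxy
      exact_mod_cast hxy
    exact ⟨q * a' - a * q', Nat.sub_pos_of_lt hlt, Nat.add_sub_cancel' hlt.le⟩
  rw [div_sub_div_eq_of_mul_add_eq hqpos hq'pos h] at hle
  have hΔD : Δ ≤ D := by
    have hprod : (q : ℝ) * q' ≤ Q ^ 2 := by
      rw [sq]
      gcongr
    have : (Δ : ℝ) ≤ D := by
      calc (Δ : ℝ) ≤ ε * (q * q') := (div_le_iff₀ (by positivity)).1 hle
        _ ≤ ε * Q ^ 2 := by gcongr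
        _ ≤ D := hD
    exact_mod_cast this
  exact ⟨⟨Δ, q, q', a⟩,
    (mem_closeQuads hε).2 ⟨⟨hΔ, hΔD⟩, hq, hq', hle, haq, hcop, a', h, hcop'⟩,
    fractionPair_eq hqpos h⟩

lemma ncard_close_pairs_eq_sum (hε : 0 < ε) (hεQ : ε * Q < 1) (hD : ε * Q ^ 2 ≤ D) :
    Set.ncard {p : ℝ × ℝ | p.1 ∈ fareyMod m b Q ∧ p.2 ∈ fareyMod m b Q ∧
      0 < p.2 - p.1 ∧ p.2 - p.1 ≤ ε} =
    ∑ Δ ∈ Finset.Icc 1 D, ∑ q ∈ denoms m b Q,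
      ∑ q' ∈ denoms m b Q with Δ / (ε * q) ≤ (q' : ℕ), pairCount q q' Δ := by
  have himage : {p : ℝ × ℝ | p.1 ∈ fareyMod m b Q ∧ p.2 ∈ fareyMod m b Q ∧
      0 < p.2 - p.1 ∧ p.2 - p.1 ≤ ε} = fractionPair '' closeQuads m b Q D ε := by
    ext ⟨x, y⟩
    constructor
    · rintro ⟨hx, hy, hxy, hle⟩
      exact exists_fractionPair_eq hε hD hx hy hxy hle
    · rintro ⟨t, ht, hxy⟩
      simpa only [hxy] using! fractionPair_mem hε hεQ (Finset.mem_coe.1 ht)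
  rw [himage, (injOn_fractionPair hε).ncard_image, Set.ncard_coe_finset, card_closeQuads]

end

/-! ### The pair correlation function -/

/-- The function `log y / y ^ 2` on `[1, ∞)`, extended by `0` to the left of `1`. -/
noncomputable def logKernel (y : ℝ) : ℝ := Real.log (max y 1) / (max y 1) ^ 2

/-- The primitive of `logKernel` that vanishes at `0`. -/
noncomputable def logPrim (y : ℝ) : ℝ := ∫ x in (0 : ℝ)..y, logKernel x

@[fun_prop]
lemma continuous_logKernel : Continuous logKernel := by
  unfold logKernel
  fun_prop (disch := intro; positivity)

lemma intervalIntegrable_logKernel (a b : ℝ) : IntervalIntegrable logKernel volume a b :=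
  continuous_logKernel.intervalIntegrable a b

lemma logKernel_of_le_one {y : ℝ} (h : y ≤ 1) : logKernel y = 0 := by
  rw [logKernel, max_eq_right h, Real.log_one, zero_div]

lemma logKernel_of_one_le {y : ℝ} (h : 1 ≤ y) : logKernel y = Real.log y / y ^ 2 := by
  rw [logKernel, max_eq_left h]

lemma logKernel_nonneg (y : ℝ) : 0 ≤ logKernel y :=
  div_nonneg (Real.log_nonneg (le_max_right _ _)) (by positivity)

lemma logKernel_le_one (y : ℝ) : logKernel y ≤ 1 := by
  have hmax : 1 ≤ max y 1 := le_max_right _ _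
  rw [logKernel, div_le_one (by positivity)]
  calc Real.log (max y 1) ≤ max y 1 := Real.log_le_self (by positivity)
    _ ≤ max y 1 ^ 2 := le_self_pow₀ hmax two_ne_zero

lemma abs_logPrim_sub_le (y z : ℝ) : |logPrim y - logPrim z| ≤ |y - z| := by
  rw [logPrim, logPrim, intervalIntegral.integral_interval_sub_left
    (intervalIntegrable_logKernel _ _) (intervalIntegrable_logKernel _ _)]
  have hle := intervalIntegral.norm_integral_le_of_norm_le_const (a := z) (b := y) (C := 1)
    (f := logKernel) fun x _ => by
      rw [Real.norm_of_nonneg (logKernel_nonneg x)]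
      exact logKernel_le_one x
  rwa [one_mul, Real.norm_eq_abs] at hle

lemma logPrim_of_le_one {y : ℝ} (h : y ≤ 1) : logPrim y = 0 := by
  rw [logPrim, intervalIntegral.integral_zero_ae]
  refine Eventually.of_forall fun x hx => logKernel_of_le_one ?_
  rcases Set.mem_uIoc.1 hx with hx | hx
  · exact hx.2.trans h
  · exact hx.2.trans zero_le_one

lemma hasDerivAt_one_sub_inv_sub_log_div {x : ℝ} (hx : x ≠ 0) :
    HasDerivAt (fun x => 1 - 1 / x - Real.log x / x) (Real.log x / x ^ 2) x := by
  have hderiv := ((hasDerivAt_const x (1 : ℝ)).sub ((hasDerivAt_const x (1 : ℝ)).div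
    (hasDerivAt_id x) hx)).sub ((Real.hasDerivAt_log hx).div (hasDerivAt_id x) hx)
  refine HasDerivAt.congr_deriv (f := fun x => 1 - 1 / x - Real.log x / x) hderiv ?_
  simp only [id]
  field_simp
  ring

lemma logPrim_of_one_le {y : ℝ} (h : 1 ≤ y) : logPrim y = 1 - 1 / y - Real.log y / y := by
  have hderiv : ∀ x ∈ Set.uIcc 1 y, HasDerivAt (fun x => 1 - 1 / x - Real.log x / x)
      (logKernel x) x := by
    intro x hx
    rw [Set.uIcc_of_le h] at hx
    rw [logKernel_of_one_le hx.1]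
    exact hasDerivAt_one_sub_inv_sub_log_div (zero_lt_one.trans_le hx.1).ne'
  rw [← sub_zero (logPrim y), ← logPrim_of_le_one le_rfl, logPrim, logPrim,
    intervalIntegral.integral_interval_sub_left (intervalIntegrable_logKernel _ _)
      (intervalIntegrable_logKernel _ _),
    intervalIntegral.integral_eq_sub_of_hasDerivAt hderiv (intervalIntegrable_logKernel _ _)]
  simp

lemma monotone_logPrim : Monotone logPrim := by
  intro y z h
  have hsub : logPrim z - logPrim y = ∫ x in y..z, logKernel x := by
    rw [logPrim, logPrim, intervalIntegral.integral_interval_sub_left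
      (intervalIntegrable_logKernel _ _) (intervalIntegrable_logKernel _ _)]
  exact sub_nonneg.1 (hsub.symm ▸ intervalIntegral.integral_nonneg h fun x _ => logKernel_nonneg x)

lemma logPrim_nonneg (y : ℝ) : 0 ≤ logPrim y := by
  rw [← logPrim_of_le_one (min_le_right y 1)]
  exact monotone_logPrim (min_le_left y 1)

lemma logPrim_three_pos : 0 < logPrim 3 := by
  rw [logPrim_of_one_le (by norm_num)]
  have := Real.log_lt_sub_one_of_pos (x := 3) (by norm_num) (by norm_num)
  linarith

lemma logPrim_le_one (y : ℝ) : logPrim y ≤ 1 := by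
  rcases le_total y 1 with h | h
  · exact (logPrim_of_le_one h).trans_le zero_le_one
  · have hy : 0 ≤ y := zero_le_one.trans h
    rw [logPrim_of_one_le h, sub_sub, sub_le_self_iff]
    exact add_nonneg (one_div_nonneg.2 hy) (div_nonneg (Real.log_nonneg h) hy)

/-- For a fixed denominator `t`, the length of the range of the denominators `q' ≤ Q` of the
fractions with a given determinant that are close to a fraction of denominator `t`. The range is
`[Q * T / t, Q]`, and it is empty when `t < T`. -/
noncomputable def rangeLength (Q T t : ℝ) : ℝ := Q * (1 - T / max t T)

section rangeLength

variable {Q T : ℝ}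

lemma rangeLength_of_le {t : ℝ} (hT : 0 < T) (h : t ≤ T) : rangeLength Q T t = 0 := by
  rw [rangeLength, max_eq_right h, div_self hT.ne', sub_self, mul_zero]

lemma monotone_rangeLength (hQ : 0 ≤ Q) (hT : 0 < T) : Monotone (rangeLength Q T) := by
  intro s t h
  have : 0 < max s T := lt_max_of_lt_right hT
  unfold rangeLength
  gcongr

lemma rangeLength_le (hQ : 0 ≤ Q) (hT : 0 < T) (t : ℝ) : rangeLength Q T t ≤ Q :=
  mul_le_of_le_one_right hQ (sub_le_self 1 (div_nonneg hT.le (hT.le.trans (le_max_right t T))))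

lemma integral_rangeLength (hQ : 0 ≤ Q) (hT : 0 < T) :
    ∫ t in (0 : ℝ)..Q, rangeLength Q T t = Q ^ 2 * logPrim (Q / T) := by
  have hzero : ∀ S, 0 ≤ S → S ≤ T → ∫ t in (0 : ℝ)..S, rangeLength Q T t = 0 := by
    intro S hS hST
    rw [intervalIntegral.integral_zero_ae]
    refine Eventually.of_forall fun x hx => rangeLength_of_le hT ?_
    rw [Set.uIoc_of_le hS] at hx
    exact hx.2.trans hST
  have hint : ∀ a c, IntervalIntegrable (rangeLength Q T) volume a c := fun a c =>
    (monotone_rangeLength hQ hT).intervalIntegrable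
  rcases le_total Q T with h | h
  · rw [logPrim_of_le_one (by rwa [div_le_one hT]), mul_zero, hzero Q hQ h]
  · have hQ0 : 0 < Q := hT.trans_le h
    have hderiv : ∀ x ∈ Set.uIcc T Q, HasDerivAt (fun x => Q * (x - T * Real.log x))
        (rangeLength Q T x) x := by
      intro x hx
      rw [Set.uIcc_of_le h] at hx
      have hx0 : x ≠ 0 := (hT.trans_le hx.1).ne'
      refine HasDerivAt.congr_deriv (f := fun x => Q * (x - T * Real.log x))
        (((hasDerivAt_id x).sub ((Real.hasDerivAt_log hx0).const_mul T)).const_mul Q) ?_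
      rw [rangeLength, max_eq_left hx.1, div_eq_mul_inv]
    rw [← intervalIntegral.integral_add_adjacent_intervals (hint 0 T) (hint T Q),
      hzero T hT.le le_rfl, zero_add, logPrim_of_one_le (by rwa [one_le_div hT]),
      intervalIntegral.integral_eq_sub_of_hasDerivAt hderiv (hint T Q),
      Real.log_div hQ0.ne' hT.ne']
    field_simp
    ring

end rangeLength

lemma totient_mul_gcd_div_eq {m Δ : ℕ} (hm : 0 < m) (hΔ : 0 < Δ) :
    (φ Δ : ℝ) * ((Nat.gcd Δ m : ℝ) / φ (Nat.gcd Δ m)) = Δ * pairWeight m Δ := by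
  have hΔ' : (Δ : ℝ) ≠ 0 := by exact_mod_cast hΔ.ne'
  rw [pairWeight, sum_divisors_moebius_invCoprime hm.ne' hΔ.ne', ← mul_assoc,
    mul_div_cancel₀ _ hΔ']

lemma pairWeight_nonneg {m Δ : ℕ} (hm : 0 < m) (hΔ : 0 < Δ) : 0 ≤ pairWeight m Δ := by
  rw [pairWeight, sum_divisors_moebius_invCoprime hm.ne' hΔ.ne']
  positivity

lemma one_div_le_pairWeight {m Δ : ℕ} (hm : 0 < m) (hΔ : 0 < Δ) :
    1 / (Δ : ℝ) ≤ pairWeight m Δ := by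
  have hφ : (1 : ℝ) ≤ φ Δ := by exact_mod_cast Nat.totient_pos.2 hΔ
  have hgcd : (1 : ℝ) ≤ (Nat.gcd Δ m : ℝ) / φ (Nat.gcd Δ m) := by
    rw [one_le_div (by exact_mod_cast Nat.totient_pos.2 (Nat.gcd_pos_of_pos_left _ hΔ))]
    exact_mod_cast Nat.totient_le _
  rw [div_le_iff₀' (by exact_mod_cast hΔ), ← totient_mul_gcd_div_eq hm hΔ]
  exact one_le_mul_of_one_le_of_one_le hφ hgcd

lemma abs_pairWeight_le (m Δ : ℕ) : |pairWeight m Δ| ≤ Δ := by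
  have hterm : ∀ e ∈ Δ.divisors, |(μ e : ℝ) * invCoprime m e| ≤ 1 := by
    intro e he
    have he : (1 : ℝ) ≤ e := by exact_mod_cast Nat.pos_of_mem_divisors he
    rw [abs_mul]
    exact mul_le_one₀ (abs_moebius_cast_le_one e) (abs_nonneg _)
      ((abs_invCoprime_le m e).trans (inv_le_one_of_one_le₀ he))
  calc |pairWeight m Δ| ≤ ∑ e ∈ Δ.divisors, |(μ e : ℝ) * invCoprime m e| :=
        Finset.abs_sum_le_sum_abs _ _
    _ ≤ #Δ.divisors • (1 : ℝ) := Finset.sum_le_card_nsmul _ _ _ hterm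
    _ ≤ Δ := by
        rw [nsmul_one]
        exact_mod_cast Nat.card_divisors_le_self Δ

section gCoprime

variable {m : ℕ}

lemma one_le_two_div_mul_iff (hm : 0 < m) {Δ : ℕ} (hΔ : 0 < Δ) (x : ℝ) :
    1 ≤ 2 / (totientDensity m * Δ) * x ↔ (Δ : ℝ) ≤ 2 * x / totientDensity m := by
  have hA := totientDensity_pos hm
  have : (0 : ℝ) < Δ := by exact_mod_cast hΔ
  rw [div_mul_eq_mul_div, one_le_div (by positivity), le_div_iff₀' hA]

lemma totient_mul_log_eq (hm : 0 < m) {Δ : ℕ} (hΔ : 0 < Δ) {x : ℝ}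
    (hx : (Δ : ℝ) ≤ 2 * x / totientDensity m) :
    (φ m : ℝ) / m * (constC m / (φ m * x) ^ 2) *
      ((φ Δ : ℝ) * ((Nat.gcd Δ m : ℝ) / φ (Nat.gcd Δ m)) *
        Real.log (2 * (φ m * x) / (constC m * Δ))) =
    2 / m * pairWeight m Δ *
      (2 / (totientDensity m * Δ) * logKernel (2 / (totientDensity m * Δ) * x)) := by
  have hφ : (0 : ℝ) < φ m := by exact_mod_cast Nat.totient_pos.2 hm
  have hA := totientDensity_pos hm
  have hΔ' : (0 : ℝ) < Δ := by exact_mod_cast hΔ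
  have hx0 : 0 < x := by
    rw [le_div_iff₀ hA] at hx
    linarith [mul_pos hΔ' hA]
  rw [logKernel_of_one_le ((one_le_two_div_mul_iff hm hΔ x).2 hx), totient_mul_gcd_div_eq hm hΔ,
    constC_eq_totient_mul hm, show 2 * ((φ m : ℝ) * x) / (φ m * totientDensity m * Δ) =
      2 / (totientDensity m * Δ) * x by field_simp]
  field_simp

lemma gCoprime_totient_mul_eq (hm : 0 < m) {D : ℕ} {x : ℝ} (hx : 0 ≤ x)
    (hD : 2 * x / totientDensity m ≤ D) :
    gCoprime m (φ m * x) = ∑ Δ ∈ Finset.Icc 1 D, 2 / m * pairWeight m Δ *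
      (2 / (totientDensity m * Δ) * logKernel (2 / (totientDensity m * Δ) * x)) := by
  have hφ : (0 : ℝ) < φ m := by exact_mod_cast Nat.totient_pos.2 hm
  have hA := totientDensity_pos hm
  have hmem : ∀ Δ : ℕ, Δ ∈ Finset.Icc 1 ⌊2 * x / totientDensity m⌋₊ ↔
      1 ≤ Δ ∧ (Δ : ℝ) ≤ 2 * x / totientDensity m := by
    intro Δ
    rw [Finset.mem_Icc, Nat.le_floor_iff (by positivity)]
  have hrange : 2 * ((φ m : ℝ) * x) / constC m = 2 * x / totientDensity m := by
    rw [constC_eq_totient_mul hm, mul_left_comm, mul_div_mul_left _ _ hφ.ne']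
  rw [gCoprime, hrange, Finset.mul_sum,
    ← Finset.sum_subset (Finset.Icc_subset_Icc_right (Nat.floor_le_of_le hD))]
  · exact Finset.sum_congr rfl fun Δ hΔ =>
      totient_mul_log_eq hm ((hmem Δ).1 hΔ).1 ((hmem Δ).1 hΔ).2
  · intro Δ hΔ hΔ'
    have hΔ1 : 0 < Δ := (Finset.mem_Icc.1 hΔ).1
    have hlt : ¬ 1 ≤ 2 / (totientDensity m * Δ) * x := fun h =>
      hΔ' ((hmem Δ).2 ⟨hΔ1, (one_le_two_div_mul_iff hm hΔ1 x).1 h⟩)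
    rw [logKernel_of_le_one (not_le.1 hlt).le, mul_zero, mul_zero]

/-- The sum to which the cumulative pair counts and the integral of the pair correlation function
both reduce, the determinants `Δ` larger than `t` contributing `0`. -/
noncomputable def logPrimSum (m D : ℕ) (t : ℝ) : ℝ :=
  ∑ Δ ∈ Finset.Icc 1 D, pairWeight m Δ * logPrim (t / Δ)

lemma abs_logPrimSum_le (m D : ℕ) (t : ℝ) : |logPrimSum m D t| ≤ D ^ 2 := by
  have hterm : ∀ Δ ∈ Finset.Icc 1 D, |pairWeight m Δ * logPrim (t / Δ)| ≤ D := by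
    intro Δ hΔ
    rw [abs_mul, abs_of_nonneg (logPrim_nonneg _)]
    calc |pairWeight m Δ| * logPrim (t / Δ) ≤ |pairWeight m Δ| :=
          mul_le_of_le_one_right (abs_nonneg _) (logPrim_le_one _)
      _ ≤ Δ := abs_pairWeight_le m Δ
      _ ≤ D := by exact_mod_cast (Finset.mem_Icc.1 hΔ).2
  refine (Finset.abs_sum_le_sum_abs _ _).trans ((Finset.sum_le_card_nsmul _ _ _ hterm).trans ?_)
  rw [nsmul_eq_mul, Nat.card_Icc, Nat.add_sub_cancel, sq]

lemma abs_logPrimSum_sub_le (m D : ℕ) (s t : ℝ) :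
    |logPrimSum m D s - logPrimSum m D t| ≤ D * |s - t| := by
  have hterm : ∀ Δ ∈ Finset.Icc 1 D,
      |pairWeight m Δ * logPrim (s / Δ) - pairWeight m Δ * logPrim (t / Δ)| ≤ |s - t| := by
    intro Δ hΔ
    have hΔ0 : (0 : ℝ) < Δ := by exact_mod_cast (Finset.mem_Icc.1 hΔ).1
    rw [← mul_sub, abs_mul]
    calc |pairWeight m Δ| * |logPrim (s / Δ) - logPrim (t / Δ)| ≤ Δ * |s / Δ - t / Δ| :=
          mul_le_mul (abs_pairWeight_le m Δ) (abs_logPrim_sub_le _ _) (abs_nonneg _) hΔ0.le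
      _ = |s - t| := by
          rw [← sub_div, abs_div, Nat.abs_cast, mul_div_cancel₀ _ hΔ0.ne']
  rw [logPrimSum, logPrimSum, ← Finset.sum_sub_distrib]
  refine (Finset.abs_sum_le_sum_abs _ _).trans ((Finset.sum_le_card_nsmul _ _ _ hterm).trans ?_)
  rw [nsmul_eq_mul, Nat.card_Icc, Nat.add_sub_cancel]

lemma logPrim_three_mul_log_le_logPrimSum (hm : 0 < m) {D : ℕ} {t : ℝ} (ht : 0 ≤ t)
    (htD : t ≤ D) : logPrim 3 * Real.log (t / 3) ≤ logPrimSum m D t := by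
  have hnonneg : ∀ Δ ∈ Finset.Icc 1 D, 0 ≤ pairWeight m Δ * logPrim (t / Δ) := fun Δ hΔ =>
    mul_nonneg (pairWeight_nonneg hm (Finset.mem_Icc.1 hΔ).1) (logPrim_nonneg _)
  have hterm : ∀ Δ ∈ Finset.Icc 1 ⌊t / 3⌋₊,
      logPrim 3 * (Δ : ℝ)⁻¹ ≤ pairWeight m Δ * logPrim (t / Δ) := by
    intro Δ hΔ
    obtain ⟨hΔ1, hΔt⟩ := Finset.mem_Icc.1 hΔ
    have hΔ0 : (0 : ℝ) < Δ := by exact_mod_cast hΔ1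
    have h3 : 3 ≤ t / Δ := by
      rwa [le_div_comm₀ three_pos hΔ0, ← Nat.le_floor_iff (by positivity)]
    rw [mul_comm, ← one_div]
    exact mul_le_mul (one_div_le_pairWeight hm hΔ1) (monotone_logPrim h3) (logPrim_nonneg 3)
      (pairWeight_nonneg hm hΔ1)
  have hsub : Finset.Icc 1 ⌊t / 3⌋₊ ⊆ Finset.Icc 1 D :=
    Finset.Icc_subset_Icc_right (Nat.floor_le_of_le (by linarith))
  calc logPrim 3 * Real.log (t / 3) ≤ logPrim 3 * (harmonic ⌊t / 3⌋₊ : ℝ) :=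
        mul_le_mul_of_nonneg_left (log_le_harmonic_floor _ (by positivity)) (logPrim_nonneg 3)
    _ = ∑ Δ ∈ Finset.Icc 1 ⌊t / 3⌋₊, logPrim 3 * (Δ : ℝ)⁻¹ := by
        rw [harmonic_eq_sum_Icc, ← Finset.mul_sum]
        push_cast
        rfl
    _ ≤ ∑ Δ ∈ Finset.Icc 1 ⌊t / 3⌋₊, pairWeight m Δ * logPrim (t / Δ) := Finset.sum_le_sum hterm
    _ ≤ logPrimSum m D t :=
        Finset.sum_le_sum_of_subset_of_nonneg hsub fun Δ hΔ _ => hnonneg Δ hΔ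

lemma integral_gCoprime (hm : 0 < m) {D : ℕ} {L : ℝ} (hL : 0 ≤ L)
    (hD : 2 * L / totientDensity m ≤ D) :
    ∫ x in (0 : ℝ)..L, gCoprime m (φ m * x) =
      2 / m * logPrimSum m D (2 * L / totientDensity m) := by
  have hA := totientDensity_pos hm
  have hcongr : ∫ x in (0 : ℝ)..L, gCoprime m (φ m * x) =
      ∫ x in (0 : ℝ)..L, ∑ Δ ∈ Finset.Icc 1 D, 2 / m * pairWeight m Δ *
        (2 / (totientDensity m * Δ) * logKernel (2 / (totientDensity m * Δ) * x)) := by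
    refine intervalIntegral.integral_congr fun x hx => ?_
    rw [Set.uIcc_of_le hL] at hx
    obtain ⟨hx0, hxL⟩ := hx
    exact gCoprime_totient_mul_eq hm hx0 (hD.trans' (by gcongr))
  rw [hcongr, intervalIntegral.integral_finsetSum fun Δ _ =>
    Continuous.intervalIntegrable (by fun_prop) _ _, logPrimSum, Finset.mul_sum]
  refine Finset.sum_congr rfl fun Δ _ => ?_
  rw [intervalIntegral.integral_const_mul, intervalIntegral.integral_const_mul,
    intervalIntegral.mul_integral_comp_mul_left, mul_zero, mul_assoc,
    div_mul_eq_mul_div 2 (totientDensity m * (Δ : ℝ)) L, logPrim, div_div]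

lemma continuousOn_gCoprime (hm : 0 < m) :
    ContinuousOn (fun x => gCoprime m (φ m * x)) (Set.Ici 0) := by
  intro x hx
  have hA := totientDensity_pos hm
  set D := ⌈2 * (x + 1) / totientDensity m⌉₊
  have heq : ∀ y, 0 ≤ y → y ≤ x + 1 → gCoprime m (φ m * y) =
      ∑ Δ ∈ Finset.Icc 1 D, 2 / m * pairWeight m Δ *
        (2 / (totientDensity m * Δ) * logKernel (2 / (totientDensity m * Δ) * y)) :=
    fun y hy hyx => gCoprime_totient_mul_eq hm hy ((Nat.le_ceil _).trans' (by gcongr))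
  have hcont : Continuous fun y => ∑ Δ ∈ Finset.Icc 1 D, 2 / m * pairWeight m Δ *
      (2 / (totientDensity m * Δ) * logKernel (2 / (totientDensity m * Δ) * y)) := by
    fun_prop
  refine hcont.continuousWithinAt.congr_of_eventuallyEq ?_ (heq x hx (le_add_of_nonneg_right
    zero_le_one))
  filter_upwards [mem_nhdsWithin_of_mem_nhds (Iio_mem_nhds (lt_add_one x)),
    self_mem_nhdsWithin] with y hyx hy
  exact heq y hy (le_of_lt hyx)

lemma gCoprime_totient_mul_nonneg (hm : 0 < m) {x : ℝ} (hx : 0 ≤ x) :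
    0 ≤ gCoprime m (φ m * x) := by
  have hA := totientDensity_pos hm
  rw [gCoprime_totient_mul_eq hm hx (Nat.le_ceil _)]
  refine Finset.sum_nonneg fun Δ hΔ => ?_
  have := pairWeight_nonneg hm (Finset.mem_Icc.1 hΔ).1
  have := logKernel_nonneg (2 / (totientDensity m * Δ) * x)
  positivity

lemma tendsto_integral_gCoprime (hm : 0 < m) :
    Tendsto (fun L : ℝ => ∫ x in (0 : ℝ)..L, gCoprime m (φ m * x)) atTop atTop := by
  have hA := totientDensity_pos hm
  have hm' : (0 : ℝ) < m := by exact_mod_cast hm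
  have harg : Tendsto (fun L : ℝ => 2 * L / totientDensity m / 3) atTop atTop :=
    ((tendsto_id.const_mul_atTop two_pos).atTop_div_const hA).atTop_div_const three_pos
  have hlog : Tendsto (fun L : ℝ => 2 / m * (logPrim 3 * Real.log (2 * L / totientDensity m / 3)))
      atTop atTop :=
    ((Real.tendsto_log_atTop.comp harg).const_mul_atTop logPrim_three_pos).const_mul_atTop
      (div_pos two_pos hm')
  refine tendsto_atTop_mono' _ ?_ hlog
  filter_upwards [eventually_ge_atTop 0] with L hL
  rw [integral_gCoprime hm hL (Nat.le_ceil _)]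
  exact mul_le_mul_of_nonneg_left
    (logPrim_three_mul_log_le_logPrimSum hm (by positivity) (Nat.le_ceil _)) (by positivity)

end gCoprime

/-! ### Asymptotics of the pair correlation -/

lemma mul_sqrt_add_mul_le (c : ℝ) {A : ℝ} (hA : 0 ≤ A) (Q : ℕ) :
    (c * √Q + A) * Q ≤ (c + A) * (Q * √Q) := by
  rcases Nat.eq_zero_or_pos Q with rfl | hQ
  · simp
  · have hsqrt : 1 ≤ √(Q : ℝ) := Real.one_le_sqrt.2 (by exact_mod_cast hQ)
    calc (c * √Q + A) * Q ≤ (c * √Q + A * √Q) * Q := by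
          gcongr
          exact le_mul_of_one_le_right hA hsqrt
      _ = (c + A) * (Q * √Q) := by ring

section

variable {m : ℕ} {b : ℤ} {Q : ℕ} {ε : ℝ}

lemma abs_card_fareyMod_sub_le (hm : 0 < m) (hb : IsCoprime b (m : ℤ)) (Q : ℕ) :
    |(#(fareyMod m b Q) : ℝ) - totientDensity m * Q ^ 2 / 2| ≤
      (12 + totientDensity m) * (Q * √Q) := by
  rw [card_fareyMod, Nat.cast_sum]
  exact (abs_sum_totient_sub_le hm hb Q).trans
    (mul_sqrt_add_mul_le 12 (totientDensity_pos hm).le Q)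

lemma abs_sum_totient_div_mul_rangeLength_sub_le (hm : 0 < m) (hb : IsCoprime b (m : ℤ)) {T : ℝ}
    (hT : 0 < T) :
    |∑ q ∈ denoms m b Q, (φ q : ℝ) / q * rangeLength Q T q -
      totientDensity m * (Q ^ 2 * logPrim (Q / T))| ≤ (12 + totientDensity m) * (Q * √Q) := by
  have hA := totientDensity_pos hm
  have hQ : (0 : ℝ) ≤ Q := Nat.cast_nonneg Q
  rw [← integral_rangeLength hQ hT]
  calc _ ≤ (12 * √Q + totientDensity m) * rangeLength Q T Q :=
        abs_sum_totient_div_mul_sub_le hm hb (monotone_rangeLength hQ hT)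
          (rangeLength_of_le hT hT.le).ge Q
    _ ≤ (12 * √Q + totientDensity m) * Q := by
        gcongr
        exact rangeLength_le hQ hT Q
    _ ≤ (12 + totientDensity m) * (Q * √Q) := mul_sqrt_add_mul_le 12 hA.le Q

lemma abs_sum_pairCount_sub_rangeLength_le (hm : 0 < m) (hb : IsCoprime b (m : ℤ)) {q Δ : ℕ}
    (hq : q ∈ denoms m b Q) (hΔ : 0 < Δ) (hε : 0 < ε) :
    |∑ q' ∈ denoms m b Q with Δ / (ε * q) ≤ (q' : ℕ), (pairCount q q' Δ : ℝ) -
      pairWeight m Δ / m * ((φ q : ℝ) / q * rangeLength Q (Δ / (ε * Q)) q)| ≤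
      4 * Δ ^ 2 * √Q := by
  obtain ⟨hq0, hqQ⟩ := (mem_denoms.1 hq).1
  have : (0 : ℝ) < q := by exact_mod_cast hq0
  have hQ0' : (0 : ℝ) < Q := by exact_mod_cast hq0.trans_le hqQ
  have : (0 : ℝ) < Δ := by exact_mod_cast hΔ
  have hiff : (Δ : ℝ) / (ε * q) ≤ Q ↔ Δ / (ε * Q) ≤ q := by
    rw [div_le_iff₀ (by positivity), div_le_iff₀ (by positivity), mul_left_comm, mul_comm (q : ℝ),
      mul_assoc, mul_left_comm]
  rcases le_or_gt ((Δ : ℝ) / (ε * q)) Q with h | h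
  · have hmain : pairWeight m Δ / m * ((φ q : ℝ) / q * rangeLength Q (Δ / (ε * Q)) q) =
        pairWeight m Δ * ((Q - Δ / (ε * q)) / m * ((φ q : ℝ) / q)) := by
      rw [rangeLength, max_eq_left (hiff.1 h)]
      field_simp
    rw [hmain]
    refine (abs_sum_pairCount_sub_le hm hb hq0 (coprime_of_mem_denoms hb hq) hΔ (by positivity)
      h).trans ?_
    gcongr
  · rw [rangeLength_of_le (by positivity) (not_le.1 (hiff.not.1 h.not_ge)).le,
      Finset.filter_false_of_mem fun q' hq' hle => h.not_ge
        (hle.trans (by exact_mod_cast (mem_denoms.1 hq').1.2)),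
      Finset.sum_empty, mul_zero, mul_zero, sub_zero, abs_zero]
    positivity

lemma abs_sum_sum_pairCount_sub_le (hm : 0 < m) (hb : IsCoprime b (m : ℤ)) (hQ : 0 < Q) {Δ : ℕ}
    (hΔ : 0 < Δ) (hε : 0 < ε) :
    |∑ q ∈ denoms m b Q, ∑ q' ∈ denoms m b Q with Δ / (ε * q) ≤ (q' : ℕ), (pairCount q q' Δ : ℝ) -
      totientDensity m / m * Q ^ 2 * (pairWeight m Δ * logPrim (ε * Q ^ 2 / Δ))| ≤
      (4 * Δ ^ 2 + Δ * (12 + totientDensity m)) * (Q * √Q) := by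
  have : (0 : ℝ) < Q := by exact_mod_cast hQ
  have : (0 : ℝ) < Δ := by exact_mod_cast hΔ
  have hm' : (1 : ℝ) ≤ m := by exact_mod_cast hm
  set T : ℝ := Δ / (ε * Q) with hT
  set S : ℝ := ∑ q ∈ denoms m b Q, (φ q : ℝ) / q * rangeLength Q T q with hS
  have hcount : |∑ q ∈ denoms m b Q, ∑ q' ∈ denoms m b Q with Δ / (ε * q) ≤ (q' : ℕ),
      (pairCount q q' Δ : ℝ) - pairWeight m Δ / m * S| ≤ Q * (4 * Δ ^ 2 * √Q) := by
    rw [hS, Finset.mul_sum, ← Finset.sum_sub_distrib]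
    refine (Finset.abs_sum_le_sum_abs _ _).trans ((Finset.sum_le_card_nsmul _ _ _ fun q hq =>
      abs_sum_pairCount_sub_rangeLength_le hm hb hq hΔ hε).trans ?_)
    have hcard : #(denoms m b Q) ≤ Q :=
      (Finset.card_filter_le _ _).trans_eq (by rw [Nat.card_Icc, Nat.add_sub_cancel])
    rw [nsmul_eq_mul]
    gcongr
  have hsum : |S - totientDensity m * (Q ^ 2 * logPrim (ε * Q ^ 2 / Δ))| ≤
      (12 + totientDensity m) * (Q * √Q) := by
    rw [show ε * (Q : ℝ) ^ 2 / Δ = Q / T by rw [hT]; field_simp]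
    exact abs_sum_totient_div_mul_rangeLength_sub_le hm hb (by positivity)
  have hweight : |pairWeight m Δ / m| ≤ Δ := by
    rw [abs_div, Nat.abs_cast]
    exact (div_le_self (abs_nonneg _) hm').trans (abs_pairWeight_le m Δ)
  calc _ ≤ Q * (4 * Δ ^ 2 * √Q) + |pairWeight m Δ / m * S -
          totientDensity m / m * Q ^ 2 * (pairWeight m Δ * logPrim (ε * Q ^ 2 / Δ))| :=
        (abs_sub_le _ _ _).trans (add_le_add_left hcount _)
    _ = Q * (4 * Δ ^ 2 * √Q) + |pairWeight m Δ / m| *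
          |S - totientDensity m * (Q ^ 2 * logPrim (ε * Q ^ 2 / Δ))| := by
        rw [← abs_mul]
        ring_nf
    _ ≤ Q * (4 * Δ ^ 2 * √Q) + Δ * ((12 + totientDensity m) * (Q * √Q)) := by gcongr
    _ = (4 * Δ ^ 2 + Δ * (12 + totientDensity m)) * (Q * √Q) := by ring

lemma abs_ncard_close_pairs_sub_le (hm : 0 < m) (hb : IsCoprime b (m : ℤ)) (hQ : 0 < Q) {D : ℕ}
    (hε : 0 < ε) (hεQ : ε * Q < 1) (hD : ε * Q ^ 2 ≤ D) :
    |(Set.ncard {p : ℝ × ℝ | p.1 ∈ fareyMod m b Q ∧ p.2 ∈ fareyMod m b Q ∧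
        0 < p.2 - p.1 ∧ p.2 - p.1 ≤ ε} : ℝ) -
      totientDensity m / m * Q ^ 2 * logPrimSum m D (ε * Q ^ 2)| ≤
      D * ((4 * D ^ 2 + D * (12 + totientDensity m)) * (Q * √Q)) := by
  have hA := totientDensity_pos hm
  rw [ncard_close_pairs_eq_sum hε hεQ hD, logPrimSum, Finset.mul_sum]
  push_cast
  rw [← Finset.sum_sub_distrib]
  refine (Finset.abs_sum_le_sum_abs _ _).trans ((Finset.sum_le_card_nsmul _ _
    ((4 * D ^ 2 + D * (12 + totientDensity m)) * (Q * √Q)) fun Δ hΔ => ?_).trans_eq ?_)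
  · obtain ⟨hΔ0, hΔD⟩ := Finset.mem_Icc.1 hΔ
    refine (abs_sum_sum_pairCount_sub_le hm hb hQ hΔ0 hε).trans ?_
    gcongr
  · rw [nsmul_eq_mul, Nat.card_Icc, Nat.add_sub_cancel]

end

lemma abs_mul_logPrimSum_sub_le {m D : ℕ} {A L : ℝ} (hm : 0 < m) (hA : 0 < A) (hL : 0 ≤ L)
    (hD : 2 * L / A ≤ D) (ρ : ℝ) :
    |A * ρ / m * logPrimSum m D (L * ρ) - 2 / m * logPrimSum m D (2 * L / A)| ≤
      2 * D ^ 2 * |A * ρ - 2| := by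
  have hm' : (1 : ℝ) ≤ m := by exact_mod_cast hm
  set s := logPrimSum m D (L * ρ)
  set t := logPrimSum m D (2 * L / A)
  have hst : 2 * |s - t| ≤ D ^ 2 * |A * ρ - 2| := by
    calc 2 * |s - t| ≤ 2 * (D * |L * ρ - 2 * L / A|) := by
          gcongr
          exact abs_logPrimSum_sub_le m D _ _
      _ = D * (2 * L / A) * |A * ρ - 2| := by
          rw [show L * ρ - 2 * L / A = L / A * (A * ρ - 2) by field_simp, abs_mul,
            abs_of_nonneg (by positivity : 0 ≤ L / A)]
          ring
      _ ≤ D * D * |A * ρ - 2| := by gcongr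
      _ = D ^ 2 * |A * ρ - 2| := by rw [sq]
  calc |A * ρ / m * s - 2 / m * t| = |(A * ρ - 2) * s + 2 * (s - t)| / m := by
        rw [← Nat.abs_cast m, ← abs_div, Nat.abs_cast]
        ring_nf
    _ ≤ |(A * ρ - 2) * s + 2 * (s - t)| := div_le_self (abs_nonneg _) hm'
    _ ≤ |A * ρ - 2| * |s| + 2 * |s - t| := by
        refine (abs_add_le _ _).trans_eq ?_
        rw [abs_mul, abs_mul, abs_two]
    _ ≤ |A * ρ - 2| * D ^ 2 + D ^ 2 * |A * ρ - 2| := by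
        gcongr
        exact abs_logPrimSum_le m D _
    _ = 2 * D ^ 2 * |A * ρ - 2| := by ring

lemma abs_totientDensity_mul_sq_div_card_sub_two_le {m : ℕ} {b : ℤ} {Q : ℕ} (hm : 0 < m)
    (hb : IsCoprime b (m : ℤ)) (hN : 0 < #(fareyMod m b Q)) :
    |totientDensity m * (Q ^ 2 / #(fareyMod m b Q)) - 2| ≤
      2 * (12 + totientDensity m) * (Q * √Q / #(fareyMod m b Q)) := by
  have hcard := abs_card_fareyMod_sub_le hm hb Q
  set A := totientDensity m
  set N : ℝ := ((#(fareyMod m b Q) : ℕ) : ℝ)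
  have hN : 0 < N := Nat.cast_pos.2 hN
  calc |A * (Q ^ 2 / N) - 2| = 2 * |N - A * Q ^ 2 / 2| / N := by
        rw [← abs_of_pos hN, ← abs_two, ← abs_mul, ← abs_div, abs_two, abs_of_pos hN,
          abs_sub_comm]
        congr 1
        field_simp
    _ ≤ 2 * ((12 + A) * (Q * √Q)) / N := by gcongr
    _ = 2 * (12 + A) * (Q * √Q / N) := by ring

lemma abs_cumulCorr_sub_integral_le {m : ℕ} {b : ℤ} {Q D : ℕ} {L : ℝ} (hm : 0 < m)
    (hb : IsCoprime b (m : ℤ)) (hQ : 0 < Q) (hL : 0 < L) (hLQ : L * Q < #(fareyMod m b Q))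
    (hDN : L * Q ^ 2 ≤ D * #(fareyMod m b Q)) (hD : 2 * L / totientDensity m ≤ D) :
    |cumulCorr (fareyMod m b Q) L - ∫ x in (0 : ℝ)..L, gCoprime m (φ m * x)| ≤
      (4 * D ^ 3 + 5 * D ^ 2 * (12 + totientDensity m)) * (Q * √Q / #(fareyMod m b Q)) := by
  have hA := totientDensity_pos hm
  set A := totientDensity m
  rw [cumulCorr, integral_gCoprime hm hL.le hD]
  set N : ℝ := ((#(fareyMod m b Q) : ℕ) : ℝ)
  have hN : 0 < N := hLQ.trans_le' (by positivity)
  set P : ℝ := ((Set.ncard {p : ℝ × ℝ | p.1 ∈ fareyMod m b Q ∧ p.2 ∈ fareyMod m b Q ∧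
    0 < p.2 - p.1 ∧ p.2 - p.1 ≤ L / N} : ℕ) : ℝ)
  set ρ : ℝ := Q ^ 2 / N with hρ
  have hcount : |1 / N * P - A * ρ / m * logPrimSum m D (L * ρ)| ≤
      D * (4 * D ^ 2 + D * (12 + A)) * (Q * √Q / N) := by
    have hP := abs_ncard_close_pairs_sub_le hm hb hQ (D := D) (div_pos hL hN)
      (by rwa [div_mul_eq_mul_div, div_lt_one hN])
      (by rwa [div_mul_eq_mul_div, div_le_iff₀ hN])
    calc _ = |P - A / m * Q ^ 2 * logPrimSum m D (L / N * Q ^ 2)| / N := by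
          rw [← abs_of_pos hN, ← abs_div, abs_of_pos hN, hρ, div_mul_eq_mul_div L,
            ← mul_div_assoc L]
          ring_nf
      _ ≤ D * ((4 * D ^ 2 + D * (12 + A)) * (Q * √Q)) / N := by gcongr
      _ = D * (4 * D ^ 2 + D * (12 + A)) * (Q * √Q / N) := by ring
  have hρ2 : |A * ρ - 2| ≤ 2 * (12 + A) * (Q * √Q / N) :=
    abs_totientDensity_mul_sq_div_card_sub_two_le hm hb (Nat.cast_pos.1 hN)
  have hlog := abs_mul_logPrimSum_sub_le hm hA hL.le hD ρ
  calc _ ≤ D * (4 * D ^ 2 + D * (12 + A)) * (Q * √Q / N) + 2 * D ^ 2 * |A * ρ - 2| :=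
        (abs_sub_le _ _ _).trans (add_le_add hcount hlog)
    _ ≤ D * (4 * D ^ 2 + D * (12 + A)) * (Q * √Q / N) +
          2 * D ^ 2 * (2 * (12 + A) * (Q * √Q / N)) := by gcongr
    _ = (4 * D ^ 3 + 5 * D ^ 2 * (12 + A)) * (Q * √Q / N) := by ring

section Bounds

variable (F : Finset ℝ)

lemma ncard_pairs_le (p : ℝ × ℝ → Prop) :
    Set.ncard {x : ℝ × ℝ | x.1 ∈ F ∧ x.2 ∈ F ∧ p x} ≤ #F * #F := by
  rw [← Finset.card_product, ← Set.ncard_coe_finset]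
  exact Set.ncard_le_ncard (fun x hx => Finset.mem_coe.2 (Finset.mem_product.2 ⟨hx.1, hx.2.1⟩))
    (Finset.finite_toSet _)

lemma one_div_card_mul_ncard_pairs_le (p : ℝ × ℝ → Prop) :
    1 / (#F : ℝ) * (Set.ncard {x : ℝ × ℝ | x.1 ∈ F ∧ x.2 ∈ F ∧ p x} : ℝ) ≤ #F := by
  rw [one_div_mul_eq_div]
  refine div_le_of_le_mul₀ (Nat.cast_nonneg _) (Nat.cast_nonneg _) ?_
  exact_mod_cast ncard_pairs_le F p

lemma pairCorr_nonneg (I : Set ℝ) : 0 ≤ pairCorr F I := by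
  unfold pairCorr
  positivity

lemma pairCorr_le_card (I : Set ℝ) : pairCorr F I ≤ #F :=
  one_div_card_mul_ncard_pairs_le F _

lemma cumulCorr_nonneg (L : ℝ) : 0 ≤ cumulCorr F L := by
  unfold cumulCorr
  positivity

lemma cumulCorr_le_card (L : ℝ) : cumulCorr F L ≤ #F :=
  one_div_card_mul_ncard_pairs_le F _

lemma cumulCorr_zero : cumulCorr F 0 = 0 := by
  have hempty : {p : ℝ × ℝ | p.1 ∈ F ∧ p.2 ∈ F ∧ 0 < p.2 - p.1 ∧ p.2 - p.1 ≤ 0 / (#F : ℝ)} = ∅ :=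
    Set.eq_empty_of_forall_notMem fun p hp =>
      hp.2.2.1.not_ge (hp.2.2.2.trans_eq (zero_div _))
  rw [cumulCorr, hempty, Set.ncard_empty, Nat.cast_zero, mul_zero]

end Bounds

section Farey

variable {m : ℕ} {b : ℤ} {Q : ℕ} {K L : ℝ}

lemma mem_Icc_of_mem_fareyMod {x : ℝ} (h : x ∈ fareyMod m b Q) : x ∈ Set.Icc (1 / (Q : ℝ)) 1 := by
  obtain ⟨a, q, ha, hq, -, rfl⟩ := mem_fareyMod.1 h
  obtain ⟨hq0, hqQ⟩ := (mem_denoms.1 hq).1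
  obtain ⟨ha1, haq⟩ := Finset.mem_Icc.1 ha
  have hq0' : (0 : ℝ) < q := by exact_mod_cast hq0
  exact ⟨div_le_div₀ (Nat.cast_nonneg a) (by exact_mod_cast ha1) hq0' (by exact_mod_cast hqQ),
    (div_le_one hq0').2 (by exact_mod_cast haq)⟩

lemma pos_of_mem_fareyMod {x : ℝ} (h : x ∈ fareyMod m b Q) : 0 < Q := by
  obtain ⟨a, q, -, hq, -⟩ := mem_fareyMod.1 h
  exact (mem_denoms.1 hq).1.1.trans_le (mem_denoms.1 hq).1.2

/- Differences of elements of `fareyMod m b Q` are at most `1 - 1 / Q` in absolute value, so an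
interval shorter than `1 / Q` meets them modulo `1` only through the integer `0`. -/
lemma pairCorr_Icc_eq_cumulCorr (hL : 0 ≤ L) (hLQ : L * Q < #(fareyMod m b Q)) :
    pairCorr (fareyMod m b Q) (Set.Icc 0 L) = cumulCorr (fareyMod m b Q) L := by
  set F := fareyMod m b Q with hF
  have hN : (0 : ℝ) < #F := hLQ.trans_le' (by positivity)
  rw [pairCorr, cumulCorr]
  congr 3
  ext ⟨x, y⟩
  refine and_congr_right fun hx => and_congr_right fun hy => ⟨?_, ?_⟩
  · rintro ⟨hne, t, ht, k, hk⟩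
    obtain ⟨hx1, hx2⟩ := mem_Icc_of_mem_fareyMod hx
    obtain ⟨hy1, hy2⟩ := mem_Icc_of_mem_fareyMod hy
    have hQ : (0 : ℝ) < Q := by exact_mod_cast pos_of_mem_fareyMod hx
    have ht0 : 0 ≤ t / #F := div_nonneg ht.1 hN.le
    have htL : t / #F ≤ L / #F := by gcongr; exact ht.2
    have hlt : L / #F < 1 / Q := by rwa [div_lt_div_iff₀ hN hQ, one_mul]
    have hQ1 : 0 < 1 / (Q : ℝ) := by positivity
    have hk0 : k = 0 := by
      have hk1 : k < 1 := by exact_mod_cast (by linarith : (k : ℝ) < 1)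
      have hk2 : -1 < k := by exact_mod_cast (by linarith : (-1 : ℝ) < k)
      omega
    rw [hk0, Int.cast_zero, add_zero] at hk
    exact ⟨(hk ▸ ht0).lt_of_ne' (sub_ne_zero.2 hne), hk ▸ htL⟩
  · rintro ⟨h0, hle⟩
    exact ⟨sub_ne_zero.1 h0.ne', (y - x) * #F, ⟨by positivity, (le_div_iff₀ hN).1 hle⟩, 0, by
      rw [mul_div_cancel_right₀ _ hN.ne', Int.cast_zero, add_zero]⟩

lemma card_fareyMod_le (m : ℕ) (b : ℤ) (Q : ℕ) : #(fareyMod m b Q) ≤ Q ^ 2 := by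
  refine Finset.card_image_le.trans ((Finset.card_filter_le _ _).trans_eq ?_)
  rw [Finset.card_product, Nat.card_Icc, Nat.add_sub_cancel, sq]

lemma eventually_le_card_fareyMod (hm : 0 < m) :
    ∀ᶠ Q : ℕ in atTop, ∀ b : ℤ, IsCoprime b (m : ℤ) →
      totientDensity m / 4 * Q ^ 2 ≤ #(fareyMod m b Q) := by
  have hA := totientDensity_pos hm
  set A := totientDensity m
  filter_upwards [(Real.tendsto_sqrt_atTop.comp
    tendsto_natCast_atTop_atTop).eventually_ge_atTop (4 * (12 + A) / A)] with Q hQ b hb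
  have hsq : √(Q : ℝ) ^ 2 = Q := Real.sq_sqrt Q.cast_nonneg
  have herr : (12 + A) * (Q * √Q) ≤ A / 4 * Q ^ 2 :=
    calc (12 + A) * (Q * √Q) = 4 * (12 + A) / A * (A / 4 * (Q * √Q)) := by field_simp
      _ ≤ √Q * (A / 4 * (Q * √Q)) := by gcongr; exact hQ
      _ = A / 4 * (Q * √Q ^ 2) := by ring
      _ = A / 4 * Q ^ 2 := by rw [hsq, sq]
  linarith [(abs_le.1 (abs_card_fareyMod_sub_le hm hb Q)).1]

lemma eventually_mul_lt_card_fareyMod (hm : 0 < m) (K : ℝ) :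
    ∀ᶠ Q : ℕ in atTop, ∀ b : ℤ, IsCoprime b (m : ℤ) → K * Q < #(fareyMod m b Q) := by
  have hA := totientDensity_pos hm
  filter_upwards [eventually_le_card_fareyMod hm, eventually_gt_atTop 0,
    tendsto_natCast_atTop_atTop.eventually_gt_atTop (4 * K / totientDensity m)]
    with Q hcard hQ hK b hb
  have : (0 : ℝ) < Q := by exact_mod_cast hQ
  rw [div_lt_iff₀ hA] at hK
  calc K * Q < Q * totientDensity m / 4 * Q := by gcongr; linarith
    _ = totientDensity m / 4 * Q ^ 2 := by ring
    _ ≤ #(fareyMod m b Q) := hcard b hb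

lemma intervalIntegrable_gCoprime (hm : 0 < m) {s t : ℝ} (hs : 0 ≤ s) (ht : 0 ≤ t) :
    IntervalIntegrable (fun x => gCoprime m (φ m * x)) volume s t :=
  ((continuousOn_gCoprime hm).mono fun _ hx => (le_min hs ht).trans hx.1).intervalIntegrable

lemma integral_gCoprime_nonneg (hm : 0 < m) {s t : ℝ} (hs : 0 ≤ s) (hst : s ≤ t) :
    0 ≤ ∫ x in s..t, gCoprime m (φ m * x) :=
  intervalIntegral.integral_nonneg hst fun _ hx => gCoprime_totient_mul_nonneg hm (hs.trans hx.1)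

lemma integral_gCoprime_mono (hm : 0 < m) (hL : 0 ≤ L) (hLK : L ≤ K) :
    ∫ x in (0 : ℝ)..L, gCoprime m (φ m * x) ≤ ∫ x in (0 : ℝ)..K, gCoprime m (φ m * x) := by
  rw [← intervalIntegral.integral_add_adjacent_intervals
    (intervalIntegrable_gCoprime hm le_rfl hL) (intervalIntegrable_gCoprime hm hL (hL.trans hLK))]
  exact le_add_of_nonneg_right (integral_gCoprime_nonneg hm hL hLK)

lemma exists_eventually_abs_corr_sub_integral_le (hm : 0 < m) (K : ℝ) :
    ∃ C : ℝ, ∀ᶠ Q : ℕ in atTop, ∀ b : ℤ, IsCoprime b (m : ℤ) → ∀ L ∈ Set.Icc 0 K,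
      |cumulCorr (fareyMod m b Q) L - ∫ x in (0 : ℝ)..L, gCoprime m (φ m * x)| ≤ C * (√Q)⁻¹ ∧
      |pairCorr (fareyMod m b Q) (Set.Icc 0 L) - ∫ x in (0 : ℝ)..L, gCoprime m (φ m * x)| ≤
        C * (√Q)⁻¹ := by
  have hA := totientDensity_pos hm
  set A := totientDensity m
  set D := ⌈4 * K / A⌉₊
  refine ⟨(4 * D ^ 3 + 5 * D ^ 2 * (12 + A)) * (4 / A), ?_⟩
  filter_upwards [eventually_le_card_fareyMod hm, eventually_mul_lt_card_fareyMod hm K,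
    eventually_gt_atTop 0] with Q hcard hKQ hQ b hb L ⟨hL, hLK⟩
  specialize hcard b hb
  have : (0 : ℝ) < Q := by exact_mod_cast hQ
  have : (0 : ℝ) < #(fareyMod m b Q) := hcard.trans_lt' (by positivity)
  have hLQ : L * Q < #(fareyMod m b Q) := (hKQ b hb).trans_le' (by gcongr)
  rw [pairCorr_Icc_eq_cumulCorr hL hLQ, and_self]
  rcases hL.eq_or_lt with rfl | hL0
  · rw [cumulCorr_zero, intervalIntegral.integral_same, sub_zero, abs_zero]
    positivity
  have hD : 4 * L / A ≤ D := (Nat.le_ceil _).trans' (by gcongr)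
  have hrate : (Q : ℝ) * √Q / #(fareyMod m b Q) ≤ 4 / A * (√Q)⁻¹ :=
    calc (Q : ℝ) * √Q / #(fareyMod m b Q) ≤ Q * √Q / (A / 4 * Q ^ 2) := by gcongr
      _ = 4 / A * (√Q / Q) := by field_simp
      _ = 4 / A * (√Q)⁻¹ := by rw [Real.sqrt_div_self]
  have hDN : L * Q ^ 2 ≤ D * #(fareyMod m b Q) :=
    calc _ = 4 * L / A * (A / 4 * Q ^ 2) := by field_simp
      _ ≤ _ := by gcongr
  calc _ ≤ (4 * D ^ 3 + 5 * D ^ 2 * (12 + A)) * (Q * √Q / #(fareyMod m b Q)) :=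
        abs_cumulCorr_sub_integral_le hm hb hQ hL0 hLQ hDN (hD.trans' (by gcongr; norm_num))
    _ ≤ (4 * D ^ 3 + 5 * D ^ 2 * (12 + A)) * (4 / A * (√Q)⁻¹) := by gcongr
    _ = _ := (mul_assoc _ _ _).symm

lemma abs_sub_integral_gCoprime_le (hm : 0 < m) (hL : 0 ≤ L) (hLK : L ≤ K) {x B : ℝ} (hx : 0 ≤ x)
    (hxB : x ≤ B) :
    |x - ∫ x in (0 : ℝ)..L, gCoprime m (φ m * x)| ≤
      B + ∫ x in (0 : ℝ)..K, gCoprime m (φ m * x) := by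
  have hmono := integral_gCoprime_mono hm hL hLK
  have hnonneg := integral_gCoprime_nonneg hm le_rfl hL
  rw [abs_le]
  constructor <;> linarith

lemma exists_abs_corr_sub_integral_le (hm : 0 < m) (K : ℝ) :
    ∃ C : ℝ, 0 ≤ C ∧ ∀ b : ℤ, IsCoprime b (m : ℤ) → ∀ Q : ℕ, 1 ≤ Q → ∀ L : ℝ, 0 ≤ L → L ≤ K →
      |cumulCorr (fareyMod m b Q) L - ∫ x in (0 : ℝ)..L, gCoprime m (φ m * x)| ≤ C * (√Q)⁻¹ ∧
      |pairCorr (fareyMod m b Q) (Set.Icc 0 L) - ∫ x in (0 : ℝ)..L, gCoprime m (φ m * x)| ≤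
        C * (√Q)⁻¹ := by
  obtain ⟨C₁, h₁⟩ := exists_eventually_abs_corr_sub_integral_le hm K
  obtain ⟨Q₀, hQ₀⟩ := eventually_atTop.1 h₁
  set C₂ := (Q₀ ^ 2 + ∫ x in (0 : ℝ)..K, gCoprime m (φ m * x)) * √Q₀ with hC₂
  refine ⟨max (max C₁ C₂) 0, le_max_right _ _, fun b hb Q hQ L hL hLK => ?_⟩
  rcases le_or_gt Q₀ Q with hQQ | hQQ
  · have hle : C₁ * (√Q)⁻¹ ≤ max (max C₁ C₂) 0 * (√Q)⁻¹ := by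
      gcongr
      exact (le_max_left _ _).trans (le_max_left _ _)
    exact (hQ₀ Q hQQ b hb L ⟨hL, hLK⟩).imp (·.trans hle) (·.trans hle)
  · have hcard : (#(fareyMod m b Q) : ℝ) ≤ Q₀ ^ 2 := by
      exact_mod_cast (card_fareyMod_le m b Q).trans (Nat.pow_le_pow_left hQQ.le 2)
    have hle : Q₀ ^ 2 + ∫ x in (0 : ℝ)..K, gCoprime m (φ m * x) ≤
        max (max C₁ C₂) 0 * (√Q)⁻¹ := by
      have hG := integral_gCoprime_nonneg hm le_rfl (hL.trans hLK)
      rw [← div_eq_mul_inv, le_div_iff₀ (by positivity)]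
      calc _ ≤ C₂ := by rw [hC₂]; gcongr
        _ ≤ _ := (le_max_right _ _).trans (le_max_left _ _)
    exact ⟨(abs_sub_integral_gCoprime_le hm hL hLK (cumulCorr_nonneg _ _)
        ((cumulCorr_le_card _ _).trans hcard)).trans hle,
      (abs_sub_integral_gCoprime_le hm hL hLK (pairCorr_nonneg _ _)
        ((pairCorr_le_card _ _).trans hcard)).trans hle⟩

end Farey

/-! ### Pair correlation measures -/

/-- The pairs of distinct elements of `F` whose difference lies in `(1/N) I + ℤ`, where `N = #F`:
these are the pairs counted by `pairCorr F I`. -/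
def corrPairs (F : Finset ℝ) (I : Set ℝ) : Set (ℝ × ℝ) :=
  {p | p.1 ∈ F ∧ p.2 ∈ F ∧ p.2 ≠ p.1 ∧ ∃ t ∈ I, ∃ k : ℤ, p.2 - p.1 = t / #F + k}

lemma pairCorr_eq (F : Finset ℝ) (I : Set ℝ) :
    pairCorr F I = 1 / (#F : ℝ) * (corrPairs F I).ncard := rfl

lemma finite_corrPairs (F : Finset ℝ) (I : Set ℝ) : (corrPairs F I).Finite :=
  (Finset.finite_toSet (F ×ˢ F)).subset fun _ h =>
    Finset.mem_coe.2 (Finset.mem_product.2 ⟨h.1, h.2.1⟩)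

lemma corrPairs_mono (F : Finset ℝ) {I J : Set ℝ} (h : I ⊆ J) : corrPairs F I ⊆ corrPairs F J :=
  fun _ ⟨h1, h2, hne, t, ht, hk⟩ => ⟨h1, h2, hne, t, h ht, hk⟩

lemma corrPairs_union (F : Finset ℝ) (I J : Set ℝ) :
    corrPairs F (I ∪ J) = corrPairs F I ∪ corrPairs F J := by
  refine Set.Subset.antisymm ?_ (Set.union_subset (corrPairs_mono F Set.subset_union_left)
    (corrPairs_mono F Set.subset_union_right))
  rintro p ⟨h1, h2, hne, t, ht, hk⟩
  exact ht.imp (fun ht => ⟨h1, h2, hne, t, ht, hk⟩) fun ht => ⟨h1, h2, hne, t, ht, hk⟩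

lemma disjoint_corrPairs {F : Finset ℝ} {I J : Set ℝ} {R : ℝ} (hI : I ⊆ Set.Icc (-R) R)
    (hJ : J ⊆ Set.Icc (-R) R) (hIJ : Disjoint I J) (hR : 2 * R < #F) :
    Disjoint (corrPairs F I) (corrPairs F J) := by
  refine Set.disjoint_left.2 fun p => ?_
  rintro ⟨-, -, -, t, ht, k, hk⟩ ⟨-, -, -, s, hs, l, hl⟩
  have htR := hI ht
  have hsR := hJ hs
  have hN : (0 : ℝ) < #F := by linarith [htR.1, htR.2]
  have hts : t - s = #F * ((l - k : ℤ) : ℝ) := by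
    have heq : t / #F + k = s / #F + l := hk.symm.trans hl
    field_simp at heq
    push_cast
    linarith
  have hlt : |((l - k : ℤ) : ℝ)| < 1 := by
    have habs : |t - s| < #F := by
      rw [abs_lt]
      constructor <;> linarith [htR.1, htR.2, hsR.1, hsR.2]
    rwa [hts, abs_mul, abs_of_pos hN, mul_lt_iff_lt_one_right hN] at habs
  have hlk : l - k = 0 := Int.abs_lt_one_iff.1 (by exact_mod_cast hlt)
  rw [hlk, Int.cast_zero, mul_zero, sub_eq_zero] at hts
  exact Set.disjoint_left.1 hIJ ht (hts ▸ hs)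

lemma image_swap_corrPairs_subset (F : Finset ℝ) (I : Set ℝ) :
    Prod.swap '' corrPairs F I ⊆ corrPairs F (Neg.neg ⁻¹' I) := by
  rintro _ ⟨p, ⟨h1, h2, hne, t, ht, k, hk⟩, rfl⟩
  refine ⟨h2, h1, hne.symm, -t, by rwa [Set.mem_preimage, neg_neg], -k, ?_⟩
  rw [Prod.snd_swap, Prod.fst_swap, ← neg_sub, hk, Int.cast_neg]
  ring

lemma pairCorr_neg_le (F : Finset ℝ) (I : Set ℝ) : pairCorr F I ≤ pairCorr F (Neg.neg ⁻¹' I) := by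
  rw [pairCorr_eq, pairCorr_eq, ← Set.ncard_image_of_injective _ Prod.swap_injective]
  gcongr
  · exact finite_corrPairs F _
  · exact image_swap_corrPairs_subset F I

lemma pairCorr_neg (F : Finset ℝ) (I : Set ℝ) : pairCorr F (Neg.neg ⁻¹' I) = pairCorr F I := by
  refine le_antisymm ?_ (pairCorr_neg_le F I)
  simpa only [Set.preimage_preimage, neg_neg, Set.preimage_id'] using
    pairCorr_neg_le F (Neg.neg ⁻¹' I)

lemma pairCorr_empty (F : Finset ℝ) : pairCorr F ∅ = 0 := by
  simp [pairCorr]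

lemma pairCorr_mono (F : Finset ℝ) {I J : Set ℝ} (h : I ⊆ J) : pairCorr F I ≤ pairCorr F J := by
  rw [pairCorr_eq, pairCorr_eq]
  gcongr
  · exact finite_corrPairs F J
  · exact corrPairs_mono F h

lemma pairCorr_union_le (F : Finset ℝ) (I J : Set ℝ) :
    pairCorr F (I ∪ J) ≤ pairCorr F I + pairCorr F J := by
  rw [pairCorr_eq, pairCorr_eq, pairCorr_eq, ← mul_add, corrPairs_union]
  gcongr
  exact_mod_cast Set.ncard_union_le _ _

lemma pairCorr_union {F : Finset ℝ} {I J : Set ℝ} {R : ℝ} (hI : I ⊆ Set.Icc (-R) R)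
    (hJ : J ⊆ Set.Icc (-R) R) (hIJ : Disjoint I J) (hR : 2 * R < #F) :
    pairCorr F (I ∪ J) = pairCorr F I + pairCorr F J := by
  rw [pairCorr_eq, pairCorr_eq, pairCorr_eq, ← mul_add, corrPairs_union,
    Set.ncard_union_eq (disjoint_corrPairs hI hJ hIJ hR) (finite_corrPairs F I)
      (finite_corrPairs F J), Nat.cast_add]

section Limit

variable {F : ℕ → Finset ℝ} {G : ℝ → ℝ} {J : Set ℝ} {a c d : ℝ}

lemma eventually_lt_pairCorr (hG : Continuous G)
    (hlim : ∀ x, Tendsto (fun n => pairCorr (F n) (Set.Icc 0 x)) atTop (𝓝 (G x)))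
    (hJ : Set.Ioo c d ⊆ J) (ha : a < G d - G c) : ∀ᶠ n in atTop, a < pairCorr (F n) J := by
  obtain ⟨y, hay, hyd⟩ : ∃ y, a < G y - G c ∧ y < d :=
    ((((hG.sub continuous_const).tendsto d).eventually_const_lt ha).filter_mono
      nhdsWithin_le_nhds |>.and (self_mem_nhdsWithin (s := Set.Iio d))).exists
  filter_upwards [((hlim y).sub (hlim c)).eventually_const_lt hay] with n hn
  have hcover : Set.Icc 0 y ⊆ Set.Icc 0 c ∪ J := fun t ht =>
    (le_or_gt t c).imp (⟨ht.1, ·⟩) fun htc => hJ ⟨htc, ht.2.trans_lt hyd⟩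
  linarith [(pairCorr_mono (F n) hcover).trans (pairCorr_union_le (F n) _ _)]

lemma eventually_pairCorr_lt (hN : Tendsto (fun n => (#(F n) : ℝ)) atTop atTop) (hG : Continuous G)
    (hlim : ∀ x, Tendsto (fun n => pairCorr (F n) (Set.Icc 0 x)) atTop (𝓝 (G x)))
    (hc : 0 ≤ c) (hcd : c ≤ d) (hJ : J ⊆ Set.Icc c d) (ha : G d - G c < a) :
    ∀ᶠ n in atTop, pairCorr (F n) J < a := by
  obtain ⟨x, hxa, hxc⟩ : ∃ x, G d - G x < a ∧ x < c :=
    ((((continuous_const.sub hG).tendsto c).eventually_lt_const ha).filter_mono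
      nhdsWithin_le_nhds |>.and (self_mem_nhdsWithin (s := Set.Iio c))).exists
  filter_upwards [((hlim d).sub (hlim x)).eventually_lt_const hxa,
    hN.eventually_gt_atTop (2 * d)] with n hn hNn
  have hx : Set.Icc 0 x ⊆ Set.Icc 0 d := Set.Icc_subset_Icc_right (hxc.le.trans hcd)
  have hJd : J ⊆ Set.Icc 0 d := hJ.trans (Set.Icc_subset_Icc_left hc)
  have hd : Set.Icc 0 d ⊆ Set.Icc (-d) d := Set.Icc_subset_Icc_left (by linarith)
  have hdisj : Disjoint (Set.Icc 0 x) J :=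
    Set.disjoint_left.2 fun t ht htJ => (ht.2.trans_lt hxc).not_ge (hJ htJ).1
  linarith [pairCorr_union (hx.trans hd) (hJd.trans hd) hdisj hNn,
    pairCorr_mono (F n) (Set.union_subset hx hJd)]

lemma tendsto_pairCorr_of_subset (hN : Tendsto (fun n => (#(F n) : ℝ)) atTop atTop)
    (hG : Continuous G)
    (hlim : ∀ x, Tendsto (fun n => pairCorr (F n) (Set.Icc 0 x)) atTop (𝓝 (G x)))
    (hc : 0 ≤ c) (hcd : c ≤ d) (hIoo : Set.Ioo c d ⊆ J) (hIcc : J ⊆ Set.Icc c d) :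
    Tendsto (fun n => pairCorr (F n) J) atTop (𝓝 (G d - G c)) :=
  tendsto_order.2 ⟨fun _ => eventually_lt_pairCorr hG hlim hIoo,
    fun _ => eventually_pairCorr_lt hN hG hlim hc hcd hIcc⟩

variable {ν : Measure ℝ}

lemma tendsto_ofReal_pairCorr_of_neg [ν.IsNegInvariant]
    (h : Tendsto (fun n => ENNReal.ofReal (pairCorr (F n) (Neg.neg ⁻¹' J))) atTop
      (𝓝 (ν (Neg.neg ⁻¹' J)))) :
    Tendsto (fun n => ENNReal.ofReal (pairCorr (F n) J)) atTop (𝓝 (ν J)) := by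
  simpa only [pairCorr_neg, Measure.measure_preimage_neg] using h

lemma tendsto_ofReal_pairCorr_union (hN : Tendsto (fun n => (#(F n) : ℝ)) atTop atTop)
    {I J : Set ℝ} {R : ℝ} (hI : I ⊆ Set.Icc (-R) R) (hJ : J ⊆ Set.Icc (-R) R)
    (hIJ : Disjoint I J) (hJm : MeasurableSet J)
    (hI_lim : Tendsto (fun n => ENNReal.ofReal (pairCorr (F n) I)) atTop (𝓝 (ν I)))
    (hJ_lim : Tendsto (fun n => ENNReal.ofReal (pairCorr (F n) J)) atTop (𝓝 (ν J))) :
    Tendsto (fun n => ENNReal.ofReal (pairCorr (F n) (I ∪ J))) atTop (𝓝 (ν (I ∪ J))) := by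
  rw [measure_union hIJ hJm]
  refine (hI_lim.add hJ_lim).congr' ?_
  filter_upwards [hN.eventually_gt_atTop (2 * R)] with n hn
  rw [pairCorr_union hI hJ hIJ hn, ENNReal.ofReal_add (pairCorr_nonneg _ _) (pairCorr_nonneg _ _)]

lemma tendsto_ofReal_pairCorr_of_not_bddAbove
    (hlim : ∀ I : Set ℝ, I.OrdConnected → I ⊆ Set.Ici 0 → BddAbove I →
      Tendsto (fun n => ENNReal.ofReal (pairCorr (F n) I)) atTop (𝓝 (ν I)))
    (hinf : ∀ a, ν (Set.Ici a) = ⊤) (hJ : J.OrdConnected) (hJb : ¬ BddAbove J) :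
    Tendsto (fun n => ENNReal.ofReal (pairCorr (F n) J)) atTop (𝓝 (ν J)) := by
  obtain ⟨a, haJ, ha⟩ : ∃ a ∈ J, 0 < a := not_bddAbove_iff.1 hJb 0
  have hsub : Set.Ici a ⊆ J := fun x hx => by
    obtain ⟨z, hz, hxz⟩ := not_bddAbove_iff.1 hJb x
    exact hJ.out haJ hz ⟨hx, hxz.le⟩
  rw [measure_mono_top hsub (hinf a)]
  refine tendsto_order.2 ⟨fun r hr => ?_, fun r hr => absurd hr not_top_lt⟩
  obtain ⟨d, hd⟩ : ∃ d, r < ν (Set.Ico a d) :=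
    ((tendsto_measure_Ico_atTop ν a).eventually_const_lt (hr.trans_eq (hinf a).symm)).exists
  filter_upwards [(hlim (Set.Ico a d) Set.ordConnected_Ico
    (Set.Ico_subset_Ici_self.trans (Set.Ici_subset_Ici.2 ha.le)) bddAbove_Ico).eventually_const_lt
    hd] with n hn
  exact hn.trans_le (ENNReal.ofReal_le_ofReal
    (pairCorr_mono _ (Set.Ico_subset_Ici_self.trans hsub)))

lemma isPairCorrMeasure_of_subset_Ici [ν.IsNegInvariant]
    (hN : Tendsto (fun n => (#(F n) : ℝ)) atTop atTop)
    (hlim : ∀ J : Set ℝ, J.OrdConnected → J ⊆ Set.Ici 0 → BddAbove J →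
      Tendsto (fun n => ENNReal.ofReal (pairCorr (F n) J)) atTop (𝓝 (ν J)))
    (hinf : ∀ a, ν (Set.Ici a) = ⊤) : IsPairCorrMeasure F ν := by
  intro I hI
  have hneg {J : Set ℝ} (hJ : J.OrdConnected) : (Neg.neg ⁻¹' J : Set ℝ).OrdConnected :=
    hJ.preimage_anti fun _ _ => neg_le_neg
  have hneg_bdd {J : Set ℝ} : BddAbove (Neg.neg ⁻¹' J : Set ℝ) ↔ BddBelow J := by
    rw [Set.neg_preimage, bddAbove_neg]
  by_cases hb : BddAbove I
  swap
  · exact tendsto_ofReal_pairCorr_of_not_bddAbove hlim hinf hI hb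
  by_cases hb' : BddBelow I
  swap
  · exact tendsto_ofReal_pairCorr_of_neg
      (tendsto_ofReal_pairCorr_of_not_bddAbove hlim hinf (hneg hI) (hneg_bdd.not.2 hb'))
  have hneg_part : (I ∩ Set.Iio 0).OrdConnected := hI.inter Set.ordConnected_Iio
  obtain ⟨a, ha⟩ := hb'
  obtain ⟨c, hc⟩ := hb
  have hR : I ⊆ Set.Icc (-max (-a) c) (max (-a) c) := fun x hx =>
    ⟨neg_le.1 ((neg_le_neg (ha hx)).trans (le_max_left _ _)), (hc hx).trans (le_max_right _ _)⟩
  have hI_eq : I ∩ Set.Ici 0 ∪ I ∩ Set.Iio 0 = I := by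
    rw [← Set.inter_union_distrib_left, Set.Ici_union_Iio, Set.inter_univ]
  rw [← hI_eq]
  refine tendsto_ofReal_pairCorr_union hN (Set.inter_subset_left.trans hR)
    (Set.inter_subset_left.trans hR) ?_ hneg_part.measurableSet ?_ ?_
  · exact Set.disjoint_left.2 fun x hx hx' => not_lt.2 (Set.mem_Ici.1 hx.2) (Set.mem_Iio.1 hx'.2)
  · exact hlim _ (hI.inter Set.ordConnected_Ici) Set.inter_subset_right ⟨c, fun x hx => hc hx.1⟩
  · refine tendsto_ofReal_pairCorr_of_neg (hlim _ (hneg hneg_part) (fun x hx => ?_)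
      (hneg_bdd.2 ⟨a, fun x hx => ha hx.1⟩))
    exact (neg_lt_zero.1 (Set.mem_Iio.1 hx.2)).le

end Limit

section Density

variable {g : ℝ → ℝ} {J : Set ℝ} {c d : ℝ}

lemma isNegInvariant_withDensity (heven : ∀ x, g (-x) = g x) :
    (volume.withDensity fun x => ENNReal.ofReal (g x)).IsNegInvariant := by
  refine ⟨Measure.ext fun S hS => ?_⟩
  rw [Measure.neg_apply, ← Set.neg_preimage, withDensity_apply _ (measurable_neg hS),
    withDensity_apply _ hS, ← (Measure.measurePreserving_neg volume).setLIntegral_comp_preimage_emb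
      (MeasurableEquiv.neg ℝ).measurableEmbedding _ S]
  simp only [heven]

lemma withDensity_ofReal_apply_of_subset (hg : Continuous g) (hg0 : ∀ x, 0 ≤ g x) (hcd : c ≤ d)
    (hIoo : Set.Ioo c d ⊆ J) (hIcc : J ⊆ Set.Icc c d) :
    volume.withDensity (fun x => ENNReal.ofReal (g x)) J = ENNReal.ofReal (∫ x in c..d, g x) := by
  set ν := volume.withDensity fun x => ENNReal.ofReal (g x)
  have hJ : ν J = ν (Set.Ioc c d) := le_antisymm
    ((measure_mono hIcc).trans_eq (measure_congr Ioc_ae_eq_Icc).symm)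
    ((measure_congr Ioo_ae_eq_Ioc).symm.trans_le (measure_mono hIoo))
  rw [hJ, withDensity_apply _ measurableSet_Ioc, intervalIntegral.integral_of_le hcd,
    ofReal_integral_eq_lintegral_ofReal (hg.intervalIntegrable c d).1 (Eventually.of_forall hg0)]

lemma withDensity_ofReal_Ici_eq_top (hg : Continuous g) (hg0 : ∀ x, 0 ≤ g x)
    (hinf : Tendsto (fun L => ∫ x in (0 : ℝ)..L, g x) atTop atTop) (a : ℝ) :
    volume.withDensity (fun x => ENNReal.ofReal (g x)) (Set.Ici a) = ⊤ := by
  set ν := volume.withDensity fun x => ENNReal.ofReal (g x)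
  have hlim : Tendsto (fun L => ENNReal.ofReal (∫ x in a..L, g x)) atTop (𝓝 ⊤) := by
    refine ENNReal.tendsto_ofReal_atTop.comp
      ((tendsto_atTop_add_const_right _ (-∫ x in (0 : ℝ)..a, g x) hinf).congr fun L => ?_)
    rw [← sub_eq_add_neg, intervalIntegral.integral_interval_sub_left (hg.intervalIntegrable _ _)
      (hg.intervalIntegrable _ _)]
  refine tendsto_nhds_unique (tendsto_measure_Ico_atTop ν a) (hlim.congr' ?_)
  filter_upwards [eventually_ge_atTop a] with L hL
  exact (withDensity_ofReal_apply_of_subset hg hg0 hL Set.Ioo_subset_Ico_self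
    Set.Ico_subset_Icc_self).symm

variable {F : ℕ → Finset ℝ}

lemma tendsto_pairCorr_Icc_max
    (hlim : ∀ L, 0 ≤ L → Tendsto (fun n => pairCorr (F n) (Set.Icc 0 L)) atTop
      (𝓝 (∫ x in (0 : ℝ)..L, g x))) (x : ℝ) :
    Tendsto (fun n => pairCorr (F n) (Set.Icc 0 x)) atTop
      (𝓝 (∫ t in (0 : ℝ)..max x 0, g t)) := by
  rcases le_or_gt 0 x with hx | hx
  · rw [max_eq_left hx]
    exact hlim x hx
  · simp only [max_eq_right hx.le, Set.Icc_eq_empty hx.not_ge, pairCorr_empty,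
      intervalIntegral.integral_same, tendsto_const_nhds]

lemma tendsto_ofReal_pairCorr_withDensity (hg : Continuous g) (hg0 : ∀ x, 0 ≤ g x)
    (hN : Tendsto (fun n => (#(F n) : ℝ)) atTop atTop)
    (hlim : ∀ L, 0 ≤ L → Tendsto (fun n => pairCorr (F n) (Set.Icc 0 L)) atTop
      (𝓝 (∫ x in (0 : ℝ)..L, g x)))
    (hJ : J.OrdConnected) (hJ0 : J ⊆ Set.Ici 0) (hJb : BddAbove J) :
    Tendsto (fun n => ENNReal.ofReal (pairCorr (F n) J)) atTop
      (𝓝 (volume.withDensity (fun x => ENNReal.ofReal (g x)) J)) := by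
  rcases J.eq_empty_or_nonempty with rfl | hne
  · simp only [pairCorr_empty, ENNReal.ofReal_zero, measure_empty, tendsto_const_nhds]
  have hbelow : BddBelow J := ⟨0, hJ0⟩
  have hIoo := IsConnected.Ioo_csInf_csSup_subset ⟨hne, hJ.isPreconnected⟩ hbelow hJb
  have hIcc := subset_Icc_csInf_csSup hbelow hJb
  have hinf : 0 ≤ sInf J := le_csInf hne hJ0
  have hle : sInf J ≤ sSup J := csInf_le_csSup hne hbelow hJb
  have hG : Continuous fun x => ∫ t in (0 : ℝ)..max x 0, g t :=
    (intervalIntegral.continuous_primitive (fun s t => hg.intervalIntegrable s t) 0).comp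
      (continuous_id.max continuous_const)
  have hmain := tendsto_pairCorr_of_subset hN hG (tendsto_pairCorr_Icc_max hlim) hinf hle hIoo hIcc
  rw [max_eq_left hinf, max_eq_left (hinf.trans hle), intervalIntegral.integral_interval_sub_left
    (hg.intervalIntegrable _ _) (hg.intervalIntegrable _ _)] at hmain
  rw [withDensity_ofReal_apply_of_subset hg hg0 hle hIoo hIcc]
  exact ENNReal.tendsto_ofReal hmain

lemma hasPairCorrFunction_of_even (hg : Continuous g) (hg0 : ∀ x, 0 ≤ g x)
    (heven : ∀ x, g (-x) = g x) (hN : Tendsto (fun n => (#(F n) : ℝ)) atTop atTop)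
    (hlim : ∀ L, 0 ≤ L → Tendsto (fun n => pairCorr (F n) (Set.Icc 0 L)) atTop
      (𝓝 (∫ x in (0 : ℝ)..L, g x)))
    (hinf : Tendsto (fun L => ∫ x in (0 : ℝ)..L, g x) atTop atTop) : HasPairCorrFunction F g := by
  have := isNegInvariant_withDensity heven
  refine ⟨volume.withDensity fun x => ENNReal.ofReal (g x),
    isPairCorrMeasure_of_subset_Ici hN
      (fun J => tendsto_ofReal_pairCorr_withDensity hg hg0 hN hlim)
      (withDensity_ofReal_Ici_eq_top hg hg0 hinf), fun L hL => ?_⟩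
  rw [withDensity_ofReal_apply_of_subset hg hg0 hL Set.Ioo_subset_Icc_self subset_rfl]
  exact ⟨ENNReal.ofReal_lt_top, hg.intervalIntegrable 0 L,
    ENNReal.toReal_ofReal (intervalIntegral.integral_nonneg hL fun x _ => hg0 x)⟩

lemma HasPairCorrFunction.congr {f : ℝ → ℝ} (h : HasPairCorrFunction F g)
    (hgf : Set.EqOn g f (Set.Ici 0)) : HasPairCorrFunction F f := by
  obtain ⟨𝒢, hlim, h𝒢⟩ := h
  refine ⟨𝒢, hlim, fun L hL => ?_⟩
  obtain ⟨hfin, hint, heq⟩ := h𝒢 L hL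
  have hL_eq : Set.EqOn g f (Set.uIcc 0 L) :=
    hgf.mono ((Set.uIcc_of_le hL).trans_subset Set.Icc_subset_Ici_self)
  exact ⟨hfin, hint.congr (hL_eq.mono Set.uIoc_subset_uIcc),
    heq.trans (intervalIntegral.integral_congr hL_eq)⟩

lemma hasPairCorrFunction_of_tendsto (hg : ContinuousOn g (Set.Ici 0)) (hg0 : ∀ x, 0 ≤ x → 0 ≤ g x)
    (hN : Tendsto (fun n => (#(F n) : ℝ)) atTop atTop)
    (hlim : ∀ L, 0 ≤ L → Tendsto (fun n => pairCorr (F n) (Set.Icc 0 L)) atTop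
      (𝓝 (∫ x in (0 : ℝ)..L, g x)))
    (hinf : Tendsto (fun L => ∫ x in (0 : ℝ)..L, g x) atTop atTop) : HasPairCorrFunction F g := by
  have habs : Set.EqOn (fun x => g |x|) g (Set.Ici 0) := fun _ hx =>
    congrArg g (abs_of_nonneg hx)
  have hint {L : ℝ} (hL : 0 ≤ L) : ∫ x in (0 : ℝ)..L, g |x| = ∫ x in (0 : ℝ)..L, g x :=
    intervalIntegral.integral_congr
      (habs.mono ((Set.uIcc_of_le hL).trans_subset Set.Icc_subset_Ici_self))
  refine HasPairCorrFunction.congr (g := fun x => g |x|) (hasPairCorrFunction_of_even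
    (hg.comp_continuous continuous_abs fun x => abs_nonneg x) (fun x => hg0 _ (abs_nonneg x))
    (fun x => congrArg g (abs_neg x)) hN (fun L hL => ?_) ?_) habs
  · rw [hint hL]
    exact hlim L hL
  · exact hinf.congr' ((eventually_ge_atTop 0).mono fun L hL => (hint hL).symm)

end Density

section Farey

variable {m : ℕ} {b : ℤ}

lemma tendsto_card_fareyMod (hm : 0 < m) (hb : IsCoprime b (m : ℤ)) :
    Tendsto (fun Q => (#(fareyMod m b Q) : ℝ)) atTop atTop := by
  refine tendsto_atTop_mono' _ ?_ tendsto_natCast_atTop_atTop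
  filter_upwards [eventually_mul_lt_card_fareyMod hm 1] with Q hQ
  exact (one_mul (Q : ℝ)).symm.trans_le (hQ b hb).le

lemma hasPairCorrFunction_fareyMod (hm : 0 < m) (hb : IsCoprime b (m : ℤ)) :
    HasPairCorrFunction (fareyMod m b) fun x => gCoprime m (φ m * x) := by
  refine hasPairCorrFunction_of_tendsto (continuousOn_gCoprime hm)
    (fun x hx => gCoprime_totient_mul_nonneg hm hx) (tendsto_card_fareyMod hm hb) (fun L hL => ?_)
    (tendsto_integral_gCoprime hm)
  obtain ⟨C, -, hC⟩ := exists_abs_corr_sub_integral_le hm L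
  have hzero : Tendsto (fun Q : ℕ => C * (√(Q : ℝ))⁻¹) atTop (𝓝 0) := by
    simpa only [mul_zero, Pi.inv_apply, Function.comp_apply] using
      (Real.tendsto_sqrt_atTop.comp tendsto_natCast_atTop_atTop).inv_tendsto_atTop.const_mul C
  refine tendsto_iff_norm_sub_tendsto_zero.2 (squeeze_zero'
    (Eventually.of_forall fun _ => norm_nonneg _) ?_ hzero)
  filter_upwards [eventually_ge_atTop 1] with Q hQ
  exact (hC b hb Q hQ L hL le_rfl).2

end Farey

end FareyPair

theorem theorem2_general (m : ℕ) (hm : 0 < m) :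
    (∀ b : ℤ, IsCoprime b (m : ℤ) →
      FareyPair.HasPairCorrFunction (FareyPair.fareyMod m b)
        (fun x => FareyPair.gCoprime m ((Nat.totient m : ℝ) * x))) ∧
    (∀ K : ℝ, ∃ C : ℝ, 0 ≤ C ∧ ∀ b : ℤ, IsCoprime b (m : ℤ) →
      ∀ Q : ℕ, 1 ≤ Q → ∀ L : ℝ, 0 ≤ L → L ≤ K →
        |FareyPair.cumulCorr (FareyPair.fareyMod m b Q) L -
            ∫ x in (0 : ℝ)..L, FareyPair.gCoprime m ((Nat.totient m : ℝ) * x)|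
          ≤ C * (Q : ℝ) ^ (-(1 / 2 : ℝ)) ∧
        |FareyPair.pairCorr (FareyPair.fareyMod m b Q) (Set.Icc 0 L) -
            ∫ x in (0 : ℝ)..L, FareyPair.gCoprime m ((Nat.totient m : ℝ) * x)|
          ≤ C * (Q : ℝ) ^ (-(1 / 2 : ℝ))) := by
  refine ⟨fun b hb => FareyPair.hasPairCorrFunction_fareyMod hm hb, fun K => ?_⟩
  have hsqrt (Q : ℕ) : (Q : ℝ) ^ (-(1 / 2 : ℝ)) = (√Q)⁻¹ := by
    rw [Real.sqrt_eq_rpow, Real.rpow_neg Q.cast_nonneg]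
  simpa only [hsqrt] using FareyPair.exists_abs_corr_sub_integral_le hm K

theorem theorem2 (m : ℕ) (hm : 0 < m) :
    (∀ b : ℤ, IsCoprime b (m : ℤ) →
      FareyPair.HasPairCorrFunction (FareyPair.fareyMod m b)
        (fun x => FareyPair.gCoprime m ((Nat.totient m : ℝ) * x))) ∧
    (∀ δ : ℝ, 0 < δ → ∀ K : ℝ, 0 < K → ∃ C : ℝ, ∀ b : ℤ, IsCoprime b (m : ℤ) →
      ∀ Q : ℕ, 1 ≤ Q → ∀ L : ℝ, 0 ≤ L → L ≤ K →
        |FareyPair.cumulCorr (FareyPair.fareyMod m b Q) L -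
            ∫ x in (0 : ℝ)..L, FareyPair.gCoprime m ((Nat.totient m : ℝ) * x)|
          ≤ C * (Q : ℝ) ^ (-(1 / 2 : ℝ) + δ) ∧
        |FareyPair.pairCorr (FareyPair.fareyMod m b Q) (Set.Icc 0 L) -
            ∫ x in (0 : ℝ)..L, FareyPair.gCoprime m ((Nat.totient m : ℝ) * x)|
          ≤ C * (Q : ℝ) ^ (-(1 / 2 : ℝ) + δ)) := by
  obtain ⟨hfun, hbound⟩ := theorem2_general m hm
  refine ⟨hfun, fun δ hδ K _ => ?_⟩
  obtain ⟨C, hC, h⟩ := hbound K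
  refine ⟨C, fun b hb Q hQ L hL hLK => ?_⟩
  have hrpow : C * (Q : ℝ) ^ (-(1 / 2 : ℝ)) ≤ C * (Q : ℝ) ^ (-(1 / 2 : ℝ) + δ) :=
    mul_le_mul_of_nonneg_left
      (Real.rpow_le_rpow_of_exponent_le (by exact_mod_cast hQ) (by linarith)) hC
  exact (h b hb Q hQ L hL hLK).imp (·.trans hrpow) (·.trans hrpow)
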